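/- **Theorem (A generalized front-door condition).** Setting. Let $\mathcal W=\mathcal V\cup\mathcal U$ be a finite set of variables, $\mathcal V$ observed with countable value sets and $\mathcal U$ unobserved with values in arbitrary measurable spaces. Let $\mathcal G$ be a directed acyclic graph on $\mathcal W$ in which the elements of $\mathcal U$ have no parents. In a semi-Markovian causal model on $\mathcal G$ the unobserved variables $\boldsymbol u$ are independent, each $v\in\mathcal V$ has a conditional law $P(v\mid \pi(v))$ given its parents $\pi(v)$ in $\mathcal G$, and the observational and interventional distributions are $$P(\boldsymbol v)=\mathbb E_{\boldsymbol u}\Big[\prod_{v\in\mathcal V}P(v\mid\pi(v))\Big],\qquad P(\boldsymbol v\mid do(\mathsf t=t))=\mathbf 1_{\mathsf t=t}\,\mathbb E_{\boldsymbol u}\Big[\prod_{v\in\mathcal V\setminus\{\mathsf t\}}P(v\mid\pi(v))\Big].$$ The causal effect $P(\mathsf y\mid do(\mathsf t=t))$ of the treatment $\mathsf t\in\mathcal V$ on the outcome $\mathsf y\in\mathcal V$ is the marginal of $P(\boldsymbol v\mid do(\mathsf t=t))$ at $\mathsf y$. Write $A\perp_d B\mid C$ if the pairwise disjoint sets $A,B,C$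 are such that $C$ blocks every path of $\mathcal G$ between a vertex of $A$ and a vertex of $B$, i.e. every such path contains either a non-endpoint non-collider in $C$ or a collider such that neither it nor any of its descendants is in $C$. Assumptions. (1) $\mathsf y$ is a descendant of $\mathsf t$ in $\mathcal G$. (2) $\mathsf t$ and $\mathsf y$ have an unobserved confounder, i.e. a common parent in $\mathcal U$. (3) $\mathbf b\subseteq\mathcal V$ is the set of all children of $\mathsf t$. Let $\mathbf z\subseteq\mathcal V\setminus(\{\mathsf t,\mathsf y\}\cup\mathbf b)$ satisfy $\mathbf b\perp_d\mathsf y\mid\{\mathsf t\}\cup\mathbf z$, and suppose that $\mathbf z$ is decomposed into $\mathbf z^{(o)}\subseteq\mathbf z$ and $\mathbf z^{(i)}=\mathbf z\setminus\mathbf z^{(o)}$ with $$\mathbf z^{(i)}\perp_d\mathsf t\qquad\text{and}\qquad \mathbf z^{(o)}\perp_d\mathsf t\mid\mathbf b\cup\mathbf z^{(i)}.$$ Conclusion. Let $\mathbf s=\mathbf b\cup\mathbf z^{(i)}$. For every value $t$ with $P(t)>0$, $$P(\mathsf y\mid do(\mathsf t=t))=\sum_{\boldsymbol z}\Big(\sum_{t'}P(\mathsf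 y\mid\boldsymbol z,t')\,P(t')\Big)P(\boldsymbol z\mid t),$$ $$P(\mathsf y\mid do(\mathsf t=t))=\sum_{\boldsymbol s}\Big(\sum_{t'}P(\mathsf y\mid\boldsymbol s,t')\,P(t')\Big)P(\boldsymbol s\mid t),$$ each formula provided that the conditional probabilities entering it with positive weight are defined: $P(\boldsymbol z,t')>0$ (respectively $P(\boldsymbol s,t')>0$) whenever $P(t')>0$ and $P(\boldsymbol z,t)>0$ (respectively $P(\boldsymbol s,t)>0$). Terms of weight zero are read as $0$. -/

import Mathlib

open scoped ENNReal

/-- A causal graph: a directed acyclic graph on the vertex set `V ⊕ U`, with observed vertices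
`Sum.inl v` and unobserved vertices `Sum.inr u`, in which unobserved vertices have no parents. -/
structure CausalGraph (V U : Type*) where
  /-- `Edge a b` means that there is an edge `a → b`. -/
  Edge : V ⊕ U → V ⊕ U → Prop
  acyclic : ∀ a, ¬ Relation.TransGen Edge a a
  latent_root : ∀ (a : V ⊕ U) (u : U), ¬ Edge a (Sum.inr u)

namespace CausalGraph

variable {V U : Type*} (G : CausalGraph V U)

/-- The observed parents of an observed vertex. -/
abbrev ObsParent (v : V) : Type _ := {a : V // G.Edge (Sum.inl a) (Sum.inl v)}

/-- The unobserved parents of an observed vertex. -/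
abbrev LatParent (v : V) : Type _ := {u : U // G.Edge (Sum.inr u) (Sum.inl v)}

/-- `b` is a (proper) descendant of `a`: there is a directed path with at least one edge
from `a` to `b`. -/
def IsDescendant (b a : V ⊕ U) : Prop := Relation.TransGen G.Edge a b

/-- `p` is a path from `a` to `b`: a sequence of distinct vertices starting at `a` and ending at
`b`, in which consecutive vertices are joined by an edge of either direction. -/
def IsPath (p : List (V ⊕ U)) (a b : V ⊕ U) : Prop :=
  p.Nodup ∧ p.IsChain (fun c d => G.Edge c d ∨ G.Edge d c) ∧
    p.head? = some a ∧ p.getLast? = some b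

/-- The path `p` is blocked by `C`: some interior vertex `w` of `p`, with neighbours `c` and `d`
on `p`, is either a non-collider that lies in `C`, or a collider such that neither `w` nor any of
its descendants lies in `C`. -/
def Blocked (p : List (V ⊕ U)) (C : Set (V ⊕ U)) : Prop :=
  ∃ c w d : V ⊕ U, [c, w, d] <:+: p ∧
    ((¬ (G.Edge c w ∧ G.Edge d w) ∧ w ∈ C) ∨
      ((G.Edge c w ∧ G.Edge d w) ∧ w ∉ C ∧ ∀ e, G.IsDescendant e w → e ∉ C))

/-- The sets `A` and `B` are d-separated by `C`: these sets are pairwise disjoint and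
`C` blocks every path from a vertex of `A` to a vertex of `B`. -/
def DSep (A B C : Set (V ⊕ U)) : Prop :=
  Disjoint A B ∧ Disjoint A C ∧ Disjoint B C ∧
    ∀ a ∈ A, ∀ b ∈ B, ∀ p, G.IsPath p a b → G.Blocked p C

/-- The set of vertices given by a finite set of observed variables. -/
def obs (S : Finset V) : Set (V ⊕ U) := Sum.inl '' (S : Set V)

end CausalGraph

/-- A semi-Markovian causal model. The observed variable `v` takes values in `X v`, the unobserved
variable `u` takes values in `Ω u`. The unobserved variables are independent with laws `law u`,
and `mech v a ω` is the conditional law `P(v | a, ω)` of `v` given that its observed parents take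
the values `a` and its unobserved parents the values `ω`. -/
structure SMCM (V U : Type*) (X : V → Type*) (Ω : U → Type*) [∀ u, MeasurableSpace (Ω u)] where
  graph : CausalGraph V U
  law : ∀ u, MeasureTheory.Measure (Ω u)
  law_prob : ∀ u, MeasureTheory.IsProbabilityMeasure (law u)
  mech : ∀ v, (∀ a : graph.ObsParent v, X a.1) → (∀ u : graph.LatParent v, Ω u.1) → PMF (X v)
  measurable_mech : ∀ v a x, Measurable (fun ω => mech v a ω x)

namespace SMCM

variable {V U : Type*} {X : V → Type*} {Ω : U → Type*} [∀ u, MeasurableSpace (Ω u)]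
  (M : SMCM V U X Ω)

/-- The factor `P(v | π(v))` at the values `x` of the observed and `ω` of the unobserved
variables. -/
noncomputable def factor (v : V) (x : ∀ v, X v) (ω : ∀ u, Ω u) : ℝ≥0∞ :=
  M.mech v (fun a => x a.1) (fun u => ω u.1) (x v)

/-- The observational distribution, as a probability mass function on the values of all observed
variables: `P(x) = E_ω [∏ v, P(x v | π(v))]`. -/
noncomputable def obsDist [Fintype V] [Fintype U] (x : ∀ v, X v) : ℝ≥0∞ :=
  ∫⁻ ω, ∏ v, M.factor v x ω ∂(MeasureTheory.Measure.pi M.law)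

open Classical in
/-- The interventional distribution `P(x | do(T = t))`: the factor of `T` is removed
and `T` is set to `t`. -/
noncomputable def doDist [Fintype V] [Fintype U] (T : V) (t : X T) (x : ∀ v, X v) : ℝ≥0∞ :=
  if x T = t then
    ∫⁻ ω, ∏ v ∈ Finset.univ.erase T, M.factor v x ω ∂(MeasureTheory.Measure.pi M.law)
  else 0

end SMCM

/-- The probability of the event `A` under the mass function `P` on a countable set. -/
noncomputable def massOf {α : Type*} (P : α → ℝ≥0∞) (A : Set α) : ℝ≥0∞ :=
  ∑' x, A.indicator P x

/-- The conditional probability `P(A | B) = P(A ∩ B) / P(B)`; it is meaningful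
when `P(B) > 0`. -/
noncomputable def condMass {α : Type*} (P : α → ℝ≥0∞) (A B : Set α) : ℝ≥0∞ :=
  massOf P (A ∩ B) / massOf P B

section Events

variable {V : Type*} {X : V → Type*}

/-- The event that the variable `v` takes the value `a`. -/
def evVar (v : V) (a : X v) : Set (∀ v, X v) := {x | x v = a}

/-- The event that the variables in `S` take the values `s`. -/
def evSet (S : Finset V) (s : ∀ v : S, X v) : Set (∀ v, X v) := {x | ∀ v : S, x v = s v}

/-- The front-door formula with the set `S`:
`∑ s, (∑ t', P(y | s, t') P(t')) P(s | t)`. -/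
noncomputable def frontDoor (P : (∀ v, X v) → ℝ≥0∞) (T Y : V) (S : Finset V)
    (t : X T) (y : X Y) : ℝ≥0∞ :=
  ∑' s : (∀ v : S, X v),
    (∑' t' : X T, condMass P (evVar Y y) (evSet S s ∩ evVar T t') * massOf P (evVar T t')) *
      condMass P (evSet S s) (evVar T t)

/-- Every conditional probability `P(y | s, t')` that enters the front-door formula with a positive
weight `P(t') P(s | t)` is defined: `P(s, t') > 0` whenever `P(t') > 0` and `P(s, t) > 0`. -/
def Overlap (P : (∀ v, X v) → ℝ≥0∞) (T : V) (S : Finset V) (t : X T) : Prop :=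
  ∀ (s : ∀ v : S, X v) (t' : X T), 0 < massOf P (evVar T t') →
    0 < massOf P (evSet S s ∩ evVar T t) → 0 < massOf P (evSet S s ∩ evVar T t')

end Events

/-- The causal effect `P(Y = y | do(T = t))`: the marginal at `y` of the interventional
distribution. -/
noncomputable def SMCM.causalEffect {V U : Type*} {X : V → Type*} {Ω : U → Type*}
    [∀ u, MeasurableSpace (Ω u)] (M : SMCM V U X Ω) [Fintype V] [Fintype U]
    (T Y : V) (t : X T) (y : X Y) : ℝ≥0∞ :=
  massOf (M.doDist T t) (evVar Y y)

/-!
The proof compares the model with its *single-world intervention* version: `T` is drawn from its own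
mechanism, but the children of `T` respond to the fixed value `t`. Write `R` for the law of the
observed variables there. The marginal of `R` at `Y` is the causal effect, `R` has the same marginal
at `T` as `P`, and `R` agrees with `P` on the event `T = t`. The front-door formula for a set `S`
(`SMCM.causalEffect_eq_frontDoor`) follows by summing `R(y, s, t')` over `s` and `t'`, once two facts
are known:

* `S` and `T` are independent under `R`, so that `R(s, t') = P(s | t) P(t')`
  (`SMCM.massOf_swigDist_evSet_inter_evVar`);
* `R(y | s, t') = P(y | s, t')` (`SMCM.massOf_swigDist_mul_massOf_obsDist`).

Both are proved with two independent copies of all variables. The variables that are no ancestors of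
the variables at hand are marginalized by replacing their kernels with point masses
(`IsKernelFamily.weightedMass_freeze`); then a set `K` of coordinates is exchanged between the copies
(`weightedMass_mul_swap`). In the first case `K` consists of the ancestors of `T`. In the second it
is the component of `Y` in the ancestral moral graph of `S ∪ {T, Y}` after `S ∪ {T}` is deleted; the
kernels involving `K` do not involve any other variable outside `S ∪ {T}`, and they are the same in
both models if no child of `T` is among them.

The graphical input consists of `CausalGraph.notMem_of_common_ancestor` and, for `S = B ∪ Zi`,
`CausalGraph.not_reach_parent_of_child`. These reason with active walks, whose inductive definition
`CausalGraph.Reach` keeps track of the direction of the last edge only; an active walk can be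
shortened to an active path (`CausalGraph.Reach.exists_activePath`), which d-separation forbids.
-/

open MeasureTheory

/-! ### Active walks and d-separation -/

namespace CausalGraph

variable {V U : Type*} (G : CausalGraph V U)

/-- The vertex `w` or one of its descendants lies in `C`: a collider at `w` is open given `C`. -/
def OpenCollider (C : Set (V ⊕ U)) (w : V ⊕ U) : Prop :=
  ∃ e ∈ C, Relation.ReflTransGen G.Edge w e

/-- `G.Reach C x w d` means that some walk from `x` to `w`, vertices possibly repeated, is active
given `C`. The flag `d` is `true` if the last edge of the walk points into `w`, and `false` if it
points out of `w` or if the walk is trivial. -/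
inductive Reach (C : Set (V ⊕ U)) (x : V ⊕ U) : V ⊕ U → Bool → Prop
  | start : Reach C x x false
  | forward {w d : V ⊕ U} {b : Bool} : Reach C x w b → w ∉ C → G.Edge w d → Reach C x d true
  | back {w d : V ⊕ U} : Reach C x w false → w ∉ C → G.Edge d w → Reach C x d false
  | collide {w d : V ⊕ U} : Reach C x w true → G.OpenCollider C w → G.Edge d w →
      Reach C x d false

/-- Active paths from `x`, listed from the endpoint back to `x`; the flag is as
in `CausalGraph.Reach`. -/
inductive ActivePath (C : Set (V ⊕ U)) (x : V ⊕ U) : List (V ⊕ U) → Bool → Prop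
  | start : ActivePath C x [x] false
  | forward {w d : V ⊕ U} {l : List (V ⊕ U)} {b : Bool} : ActivePath C x (w :: l) b → w ∉ C →
      G.Edge w d → d ∉ w :: l → ActivePath C x (d :: w :: l) true
  | back {w d : V ⊕ U} {l : List (V ⊕ U)} : ActivePath C x (w :: l) false → w ∉ C →
      G.Edge d w → d ∉ w :: l → ActivePath C x (d :: w :: l) false
  | collide {w d : V ⊕ U} {l : List (V ⊕ U)} : ActivePath C x (w :: l) true →
      G.OpenCollider C w → G.Edge d w → d ∉ w :: l → ActivePath C x (d :: w :: l) false

variable {G} {C : Set (V ⊕ U)} {x : V ⊕ U}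

theorem edge_asymm {a b : V ⊕ U} (h : G.Edge a b) : ¬ G.Edge b a := fun h' =>
  G.acyclic a ((Relation.TransGen.single h).tail h')

theorem ne_of_edge {a b : V ⊕ U} (h : G.Edge a b) : a ≠ b := by
  rintro rfl
  exact edge_asymm h h

theorem OpenCollider.of_reflTransGen {w d : V ⊕ U} (h : Relation.ReflTransGen G.Edge w d)
    (hd : G.OpenCollider C d) : G.OpenCollider C w := by
  obtain ⟨e, he, hde⟩ := hd
  exact ⟨e, he, h.trans hde⟩

theorem ActivePath.isPath {l : List (V ⊕ U)} {b : Bool} (h : G.ActivePath C x l b) :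
    ∀ w ∈ l.head?, G.IsPath l w x := by
  induction h with
  | start => simp [IsPath]
  | forward _ _ he hd ih | back _ _ he hd ih | collide _ _ he hd ih =>
    intro w' hw'
    obtain ⟨h1, h2, -, h4⟩ := ih _ rfl
    exact ⟨List.nodup_cons.2 ⟨hd, h1⟩,
      List.isChain_cons_cons.2 ⟨by simp [he], h2⟩, hw', by simpa using h4⟩

theorem ActivePath.edge {l : List (V ⊕ U)} {b : Bool} (h : G.ActivePath C x l b)
    {w e : V ⊕ U} {l' : List (V ⊕ U)} (hl : l = w :: e :: l') :
    (b = true ∧ G.Edge e w) ∨ (b = false ∧ G.Edge w e) := by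
  cases h <;> simp_all

theorem ActivePath.not_blocked {l : List (V ⊕ U)} {b : Bool} (h : G.ActivePath C x l b) :
    ¬ G.Blocked l C := by
  -- Only the triple created by the last step is new.
  have key : ∀ {w d : V ⊕ U} {l : List (V ⊕ U)}, ¬ G.Blocked (w :: l) C →
      (∀ e l', l = e :: l' → ¬ ((¬ (G.Edge d w ∧ G.Edge e w) ∧ w ∈ C) ∨
        ((G.Edge d w ∧ G.Edge e w) ∧ w ∉ C ∧ ∀ e, G.IsDescendant e w → e ∉ C))) →
      ¬ G.Blocked (d :: w :: l) C := by
    rintro w d l hl hnew ⟨c, w', e, hin, hblock⟩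
    rcases List.infix_cons_iff.1 hin with hpre | hin
    · obtain ⟨r, hr⟩ := hpre
      simp only [List.cons_append, List.nil_append, List.cons.injEq] at hr
      obtain ⟨rfl, rfl, hr⟩ := hr
      exact hnew e r hr.symm hblock
    · exact hl ⟨c, w', e, hin, hblock⟩
  induction h with
  | start =>
    rintro ⟨c, w, d, hin, -⟩
    simpa using hin.length_le
  | forward _ hw he _ ih =>
    refine key ih fun e l' _ => ?_
    have := edge_asymm he
    tauto
  | back hp hw he _ ih =>
    refine key ih fun e l' hl => ?_
    subst hl
    rcases hp.edge rfl with h | h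
    · simp at h
    · have := edge_asymm h.2
      tauto
  | collide hp hw he _ ih =>
    refine key ih fun e l' hl => ?_
    subst hl
    rcases hp.edge rfl with h | h
    · obtain ⟨a, ha, hwa⟩ := hw
      rcases Relation.reflTransGen_iff_eq_or_transGen.1 hwa with rfl | hwa
      · tauto
      · have := fun hh : ∀ e, G.IsDescendant e _ → e ∉ C => hh a hwa ha
        tauto
    · simp at h

/-- Cutting an active path at an inner vertex `d`. If the last edge of the shorter path points
into `d`, and `d` is not a collider of the original path, then the original path leaves `d` along a
directed path, which ends either at an open collider or at the endpoint `w`. -/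
theorem ActivePath.truncate {l : List (V ⊕ U)} {b : Bool} (h : G.ActivePath C x l b) :
    ∀ w l', l = w :: l' → ∀ d ∈ l', ∃ m b', G.ActivePath C x (d :: m) b' ∧
      (b' = false → d ∉ C) ∧
      (b' = true → G.OpenCollider C d ∨ (Relation.ReflTransGen G.Edge d w ∧ b = true)) := by
  induction h with
  | start => simp
  | @forward w d' l b hp hw he _ ih =>
    rintro _ _ ⟨⟩ d hd
    rcases List.mem_cons.1 hd with rfl | hd
    · exact ⟨_, _, hp, fun _ => hw, fun _ => .inr ⟨.single he, rfl⟩⟩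
    · obtain ⟨m, b', h1, h2, h3⟩ := ih _ _ rfl d hd
      exact ⟨m, b', h1, h2, fun hb => (h3 hb).imp_right fun h => ⟨h.1.tail he, rfl⟩⟩
  | @back w d' l hp hw he _ ih =>
    rintro _ _ ⟨⟩ d hd
    rcases List.mem_cons.1 hd with rfl | hd
    · exact ⟨_, _, hp, fun _ => hw, by simp⟩
    · obtain ⟨m, b', h1, h2, h3⟩ := ih _ _ rfl d hd
      exact ⟨m, b', h1, h2, fun hb => (h3 hb).imp_right fun h => by simp at h⟩
  | @collide w d' l hp hw he _ ih =>
    rintro _ _ ⟨⟩ d hd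
    rcases List.mem_cons.1 hd with rfl | hd
    · exact ⟨_, _, hp, by simp, fun _ => .inl hw⟩
    · obtain ⟨m, b', h1, h2, h3⟩ := ih _ _ rfl d hd
      exact ⟨m, b', h1, h2, fun hb => .inl ((h3 hb).elim id fun h => hw.of_reflTransGen h.1)⟩

/-- An active walk can be replaced by an active path with the same endpoints. The last edges of the
two may differ, but every continuation that keeps the walk active also keeps the path active; this
is what the last two clauses say. -/
theorem Reach.exists_activePath {w : V ⊕ U} {b : Bool} (h : G.Reach C x w b) :
    ∃ l b', G.ActivePath C x (w :: l) b' ∧ (b = true → b' = false → w ∉ C) ∧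
      (b = false → b' = true → w ∉ C → G.OpenCollider C w) := by
  induction h with
  | start => exact ⟨[], false, .start, by simp, by simp⟩
  | @forward w d b _ hw he ih =>
    obtain ⟨l, b', hp, -, -⟩ := ih
    by_cases hd : d ∈ w :: l
    · obtain ⟨m, b'', h1, h2, -⟩ := hp.truncate _ _ rfl d
        ((List.mem_cons.1 hd).resolve_left (ne_of_edge he).symm)
      exact ⟨m, b'', h1, fun _ => h2, by simp⟩
    · exact ⟨_, _, hp.forward hw he hd, by simp, by simp⟩
  | @back w d _ hw he ih =>
    obtain ⟨l, b', hp, -, ho⟩ := ih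
    by_cases hd : d ∈ w :: l
    · obtain ⟨m, b'', h1, -, h3⟩ := hp.truncate _ _ rfl d
        ((List.mem_cons.1 hd).resolve_left (ne_of_edge he))
      exact ⟨m, b'', h1, by simp, fun _ hb _ => (h3 hb).elim id
        fun h => (ho rfl h.2 hw).of_reflTransGen h.1⟩
    · cases b' with
      | false => exact ⟨_, _, hp.back hw he hd, by simp, by simp⟩
      | true => exact ⟨_, _, hp.collide (ho rfl rfl hw) he hd, by simp, by simp⟩
  | @collide w d _ ho he ih =>
    obtain ⟨l, b', hp, hw, -⟩ := ih
    by_cases hd : d ∈ w :: l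
    · obtain ⟨m, b'', h1, -, h3⟩ := hp.truncate _ _ rfl d
        ((List.mem_cons.1 hd).resolve_left (ne_of_edge he))
      exact ⟨m, b'', h1, by simp, fun _ hb _ => (h3 hb).elim id
        fun h => ho.of_reflTransGen h.1⟩
    · cases b' with
      | false => exact ⟨_, _, hp.back (hw rfl rfl) he hd, by simp, by simp⟩
      | true => exact ⟨_, _, hp.collide ho he hd, by simp, by simp⟩

theorem DSep.not_reach {A B : Set (V ⊕ U)} (h : G.DSep A B C) {a : V ⊕ U} (ha : a ∈ A)
    (hx : x ∈ B) (b : Bool) : ¬ G.Reach C x a b := by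
  intro hr
  obtain ⟨l, b', hp, -⟩ := hr.exists_activePath
  exact hp.not_blocked (h.2.2.2 a ha x hx _ (hp.isPath a rfl))

theorem IsPath.reverse {p : List (V ⊕ U)} {a b : V ⊕ U} (h : G.IsPath p a b) :
    G.IsPath p.reverse b a := by
  obtain ⟨h1, h2, h3, h4⟩ := h
  refine ⟨List.nodup_reverse.2 h1, ?_, by simpa using h4, by simpa using h3⟩
  rw [List.isChain_reverse]
  exact h2.imp fun _ _ => Or.symm

theorem Blocked.of_reverse {p : List (V ⊕ U)} (h : G.Blocked p.reverse C) : G.Blocked p C := by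
  obtain ⟨c, w, d, hin, hb⟩ := h
  refine ⟨d, w, c, ?_, by simpa only [and_comm] using hb⟩
  rw [← List.reverse_infix]
  simpa using hin

theorem DSep.symm {A B : Set (V ⊕ U)} (h : G.DSep A B C) : G.DSep B A C :=
  ⟨h.1.symm, h.2.2.1, h.2.1, fun b hb a ha _ hp =>
    (h.2.2.2 a ha b hb _ hp.reverse).of_reverse⟩

theorem Reach.of_reflTransGen {w d : V ⊕ U} {b : Bool} (h : G.Reach C x w b)
    (hwd : Relation.ReflTransGen G.Edge w d)
    (hC : ∀ e, Relation.ReflTransGen G.Edge w e → Relation.TransGen G.Edge e d → e ∉ C) :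
    ∃ b', G.Reach C x d b' := by
  induction hwd with
  | refl => exact ⟨b, h⟩
  | tail h1 he ih =>
    obtain ⟨b', h'⟩ := ih fun e h2 h3 => hC e h2 (h3.tail he)
    exact ⟨true, h'.forward (hC _ h1 (.single he)) he⟩

/-! ### Separation in the ancestral moral graph -/

/-- `w` is an ancestor of, or equal to, a vertex of `C ∪ {x}`. -/
def Anc (G : CausalGraph V U) (C : Set (V ⊕ U)) (x w : V ⊕ U) : Prop :=
  G.OpenCollider C w ∨ Relation.ReflTransGen G.Edge w x

theorem Anc.of_edge {w d : V ⊕ U} (h : G.Anc C x d) (he : G.Edge w d) : G.Anc C x w :=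
  h.imp (OpenCollider.of_reflTransGen (.single he)) (.head he)

/-- The vertices outside `C`, in the ancestral set of `C ∪ {x}`, that are joined to `x` by an
active walk. It is the component of `x` in the ancestral moral graph after `C` is deleted. -/
def comp (G : CausalGraph V U) (C : Set (V ⊕ U)) (x : V ⊕ U) : Set (V ⊕ U) :=
  {w | G.Anc C x w ∧ w ∉ C ∧ ∃ b, G.Reach C x w b}

theorem Anc.open_or_reach {w : V ⊕ U} (h : G.Anc C x w) :
    G.OpenCollider C w ∨ G.Reach C x w false := by
  by_cases ho : G.OpenCollider C w
  · exact .inl ho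
  refine .inr ?_
  have hwx := h.resolve_left ho
  clear h
  induction hwx using Relation.ReflTransGen.head_induction_on with
  | refl => exact .start
  | @head a c he hr ih =>
    have hc : ¬ G.OpenCollider C c := fun h => ho (h.of_reflTransGen (.single he))
    exact (ih hc).back (fun h => hc ⟨c, h, .refl⟩) he

theorem Reach.back_of_anc {w d : V ⊕ U} {b : Bool} (h : G.Reach C x w b) (hw : G.Anc C x w)
    (hwC : w ∈ C → b = true) (he : G.Edge d w) : G.Reach C x d false := by
  rcases hw.open_or_reach with ho | hr
  · cases b with
    | true => exact h.collide ho he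
    | false => exact h.back (fun h => by simpa using hwC h) he
  · by_cases hC : w ∈ C
    · obtain rfl := hwC hC
      exact h.collide ⟨w, hC, .refl⟩ he
    · exact hr.back hC he

/-- A family (a vertex with its parents) that lies in the ancestral set and meets the component
is contained in the component and `C`. -/
theorem family_subset_comp {v : V ⊕ U} (hv : G.Anc C x v)
    (h : v ∈ G.comp C x ∨ ∃ w ∈ G.comp C x, G.Edge w v) :
    (v ∈ G.comp C x ∨ v ∈ C) ∧ ∀ w, G.Edge w v → w ∈ G.comp C x ∨ w ∈ C := by
  have hr : ∃ b, G.Reach C x v b ∧ (v ∈ C → b = true) := by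
    rcases h with ⟨-, hC, b, hb⟩ | ⟨w, ⟨-, hC, b, hb⟩, he⟩
    · exact ⟨b, hb, fun h => (hC h).elim⟩
    · exact ⟨true, hb.forward hC he, fun _ => rfl⟩
  obtain ⟨b, hb, hbC⟩ := hr
  constructor
  · by_cases hC : v ∈ C
    · exact .inr hC
    · exact .inl ⟨hv, hC, b, hb⟩
  · intro w he
    by_cases hC : w ∈ C
    · exact .inr hC
    · exact .inl ⟨hv.of_edge he, hC, _, hb.back_of_anc hv hbC he⟩

/-! ### Graphical consequences of the front-door assumptions -/

theorem mem_obs {S : Finset V} {v : V} : (Sum.inl v : V ⊕ U) ∈ obs S ↔ v ∈ S := by simp [obs]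

theorem inr_notMem_obs {S : Finset V} {u : U} : (Sum.inr u : V ⊕ U) ∉ obs S := by simp [obs]

/-- The edges of the graph in which the edges out of `T` are deleted. -/
def EdgeAvoiding (G : CausalGraph V U) (T : V) (a b : V ⊕ U) : Prop :=
  G.Edge a b ∧ a ≠ Sum.inl T

variable [DecidableEq V] {T Y : V} {B Zi Zo : Finset V}

/-- After the edges out of the treatment are deleted, no ancestor of the treatment is an ancestor
of `B ∪ Z`. A path `T ← ⋯ ← a → ⋯ → v` that first meets `B ∪ Z` in `v` would connect `T` with `v`
given `B ∪ Zi`, and, prolonged by `Y ← u → T` at the collider `T`, would connect `Y` with `v`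
given `{T} ∪ Z`. -/
theorem notMem_of_common_ancestor {Z : Finset V}
    (hconf : ∃ u : U, G.Edge (Sum.inr u) (Sum.inl T) ∧ G.Edge (Sum.inr u) (Sum.inl Y))
    (hYT : Y ≠ T) (hYZ : Y ∉ Z) (hZ : ∀ v ∈ Z, v ∈ Zo ∨ v ∈ Zi)
    (hZiZ : Zi ⊆ Z)
    (hsep : G.DSep (obs B) (obs {Y}) (obs ({T} ∪ Z)))
    (hsepi : G.DSep (obs Zi) (obs {T}) ∅)
    (hsepo : G.DSep (obs Zo) (obs {T}) (obs (B ∪ Zi)))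
    {a w : V ⊕ U} (ha : Relation.ReflTransGen G.Edge a (Sum.inl T))
    (hw : Relation.ReflTransGen (G.EdgeAvoiding T) a w) : w ∉ obs (B ∪ Z) := by
  -- The three active walks that are carried along the path.
  let R (w : V ⊕ U) (b : Bool) : Prop := G.Reach ∅ (Sum.inl T) w b ∧
    G.Reach (obs (B ∪ Zi)) (Sum.inl T) w b ∧
    ∃ b', G.Reach (obs ({T} ∪ Z)) (Sum.inl Y) w b' ∧ (w = Sum.inl T → b' = true) ∧
      (w ≠ Sum.inl T → b' = b)
  have hR : ∀ w b, R w b → w ∉ obs (B ∪ Z) := by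
    rintro (v | u) b ⟨h1, h2, b', h3, -⟩
    · rw [mem_obs, Finset.mem_union]
      rintro (h | h)
      · exact hsep.not_reach (mem_obs.2 h) (mem_obs.2 (by simp)) _ h3
      · rcases hZ v h with h | h
        · exact hsepo.not_reach (mem_obs.2 h) (mem_obs.2 (by simp)) _ h2
        · exact hsepi.not_reach (mem_obs.2 h) (mem_obs.2 (by simp)) _ h1
    · exact inr_notMem_obs
  have hBZi : ∀ w : V ⊕ U, w ∉ obs (B ∪ Z) → w ∉ obs (B ∪ Zi) := by
    rintro (v | u) h
    · simp only [mem_obs, Finset.mem_union] at h ⊢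
      exact fun h' => h (h'.imp_right fun h => hZiZ h)
    · exact inr_notMem_obs
  have hTZ' : ∀ w : V ⊕ U, w ∉ obs (B ∪ Z) → w ≠ Sum.inl T → w ∉ obs ({T} ∪ Z) := by
    rintro (v | u) h hT
    · simp only [mem_obs, Finset.mem_union, Finset.mem_singleton, ne_eq, Sum.inl.injEq] at *
      tauto
    · exact inr_notMem_obs
  have hstart : R (Sum.inl T) false := by
    obtain ⟨u, huT, huY⟩ := hconf
    refine ⟨.start, .start, true, ?_, by simp, by simp⟩
    have h0 : G.Reach (obs ({T} ∪ Z)) (Sum.inl Y) (Sum.inl Y) false := .start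
    refine (h0.back ?_ huY).forward inr_notMem_obs huT
    simp [mem_obs, hYT, hYZ]
  have hanc : R a false := by
    clear hw
    induction ha using Relation.ReflTransGen.head_induction_on with
    | refl => exact hstart
    | @head a c he hcT ih =>
      have haT : a ≠ Sum.inl T := by
        rintro rfl
        exact G.acyclic _ (Relation.TransGen.head' he hcT)
      have ⟨h1, h2, b', h3, h4, h5⟩ := ih
      refine ⟨h1.back (by simp) he, h2.back (hBZi _ (hR _ _ ih)) he, false, ?_, by simp [haT],
        fun _ => rfl⟩
      by_cases hc : c = Sum.inl T
      · obtain rfl := h4 hc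
        exact h3.collide ⟨c, by simp [hc, mem_obs], .refl⟩ he
      · obtain rfl := h5 hc
        exact h3.back (hTZ' _ (hR _ _ ih) hc) he
  have hdir : ∃ b, R w b := by
    induction hw with
    | refl => exact ⟨_, hanc⟩
    | @tail w d _ he ih =>
      obtain ⟨b, ih⟩ := ih
      have ⟨h1, h2, b', h3, _⟩ := ih
      exact ⟨true, h1.forward (by simp) he.1, h2.forward (hBZi _ (hR _ _ ih)) he.1, true,
        h3.forward (hTZ' _ (hR _ _ ih) he.2) he.1, fun _ => rfl, fun _ => rfl⟩
  obtain ⟨b, h⟩ := hdir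
  exact hR _ _ h

/-- A walk from `Y` that is active given `{T} ∪ B ∪ Zi` does not reach a parent of a child of the
treatment. As long as it meets no vertex of `Zo`, it is active given `{T} ∪ Z` as well, for a
collider that is opened by `B` alone has a directed path to `B`, along which `B` would be connected
with `Y`. From the last vertex of `Zo` on, it is active given `B ∪ Zi`, and would connect `Zo`
with `T`. -/
theorem not_reach_parent_of_child {Z : Finset V}
    (hB : ∀ v, v ∈ B ↔ G.Edge (Sum.inl T) (Sum.inl v))
    (hZ : ∀ v, v ∈ Z ↔ v ∈ Zo ∨ v ∈ Zi)
    (hsep : G.DSep (obs B) (obs {Y}) (obs ({T} ∪ Z)))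
    (hsepo : G.DSep (obs Zo) (obs {T}) (obs (B ∪ Zi)))
    {w : V ⊕ U} {b : Bool} (h : G.Reach (obs ({T} ∪ (B ∪ Zi))) (Sum.inl Y) w b)
    (hw : w ∉ obs ({T} ∪ (B ∪ Zi))) {v : V} (hv : v ∈ B) : ¬ G.Edge w (Sum.inl v) := by
  have hY : ∀ v ∈ B, ∀ b, ¬ G.Reach (obs ({T} ∪ Z)) (Sum.inl Y) (Sum.inl v) b := fun v hv b =>
    hsep.not_reach (mem_obs.2 hv) (mem_obs.2 (by simp)) b
  have hsplit : ∀ w : V ⊕ U, w ∉ obs ({T} ∪ (B ∪ Zi)) → w ∈ obs Zo ∨ w ∉ obs ({T} ∪ Z) := by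
    rintro (v | u) h
    · simp only [mem_obs, Finset.mem_union, Finset.mem_singleton, hZ] at h ⊢
      tauto
    · exact .inr inr_notMem_obs
  have hsub : ∀ w : V ⊕ U, w ∉ obs ({T} ∪ (B ∪ Zi)) → w ∉ obs (B ∪ Zi) := by
    rintro (v | u) h
    · simp only [mem_obs, Finset.mem_union, Finset.mem_singleton] at h ⊢
      tauto
    · exact inr_notMem_obs
  have hfresh : ∀ w ∈ obs Zo, G.Reach (obs (B ∪ Zi)) w w false := fun w _ => .start
  -- An ancestor of `T` is an ancestor of `v`, since `T → v`.
  have hopen : ∀ w, G.OpenCollider (obs ({T} ∪ (B ∪ Zi))) w →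
      G.OpenCollider (obs (B ∪ Zi)) w := by
    rintro w ⟨e | u, he, hwe⟩
    · simp only [mem_obs, Finset.mem_union, Finset.mem_singleton] at he
      rcases he with rfl | he
      · exact ⟨_, mem_obs.2 (Finset.mem_union_left _ hv), hwe.tail ((hB v).1 hv)⟩
      · exact ⟨_, mem_obs.2 (Finset.mem_union.2 he), hwe⟩
    · exact (inr_notMem_obs he).elim
  have key : G.Reach (obs ({T} ∪ Z)) (Sum.inl Y) w b ∨
      ∃ z ∈ obs Zo, G.Reach (obs (B ∪ Zi)) z w b := by
    clear hw
    induction h with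
    | start => exact .inl .start
    | @forward w d b _ hw he ih =>
      rcases ih with ih | ⟨z, hz, ih⟩
      · rcases hsplit w hw with hz | hC
        · exact .inr ⟨w, hz, (hfresh w hz).forward (hsub w hw) he⟩
        · exact .inl (ih.forward hC he)
      · exact .inr ⟨z, hz, ih.forward (hsub w hw) he⟩
    | @back w d _ hw he ih =>
      rcases ih with ih | ⟨z, hz, ih⟩
      · rcases hsplit w hw with hz | hC
        · exact .inr ⟨w, hz, (hfresh w hz).back (hsub w hw) he⟩
        · exact .inl (ih.back hC he)
      · exact .inr ⟨z, hz, ih.back (hsub w hw) he⟩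
    | @collide w d _ ho he ih =>
      rcases ih with ih | ⟨z, hz, ih⟩
      · left
        by_cases ho' : G.OpenCollider (obs ({T} ∪ Z)) w
        · exact ih.collide ho' he
        exfalso
        obtain ⟨e | u, hC, hwe⟩ := ho
        · have heC : e ∉ {T} ∪ Z := fun h => ho' ⟨_, mem_obs.2 h, hwe⟩
          have heB : e ∈ B := by
            simp only [mem_obs, Finset.mem_union, Finset.mem_singleton, hZ] at hC heC
            tauto
          obtain ⟨b', hb'⟩ := ih.of_reflTransGen hwe fun c hwc _ hc => ho' ⟨c, hc, hwc⟩
          exact hY e heB _ hb'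
        · exact inr_notMem_obs hC
      · exact .inr ⟨z, hz, ih.collide (hopen w ho) he⟩
  intro he
  have hz : ∃ z ∈ obs Zo, ∃ b, G.Reach (obs (B ∪ Zi)) z w b := by
    rcases key with h | ⟨z, hz, h⟩
    · rcases hsplit w hw with hz | hC
      · exact ⟨w, hz, _, hfresh w hz⟩
      · exact (hY v hv _ (h.forward hC he)).elim
    · exact ⟨z, hz, _, h⟩
  obtain ⟨z, hz, b, h⟩ := hz
  refine hsepo.symm.not_reach (mem_obs.2 (Finset.mem_singleton_self T)) hz false
    ((h.forward (hsub w hw) he).collide ⟨_, mem_obs.2 (Finset.mem_union_left _ hv), .refl⟩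
      ((hB v).1 hv))

end CausalGraph

/-! ### Swapping coordinates between two independent copies -/

/-- The first component of the exchange of the coordinates in `K` between `x` and `y`: it has the
coordinates of `y` in `K` and those of `x` outside. -/
noncomputable def swapIn {ι : Type*} {α : ι → Type*} (K : Set ι) (x y : ∀ i, α i) : ∀ i, α i :=
  open Classical in K.piecewise y x

section Swap

variable {ι : Type*} {α : ι → Type*} {K : Set ι} {x y : ∀ i, α i} {i : ι}

theorem swapIn_of_mem (h : i ∈ K) : swapIn K x y i = y i := by
  simp [swapIn, h]

theorem swapIn_of_notMem (h : i ∉ K) : swapIn K x y i = x i := by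
  simp [swapIn, h]

theorem swapIn_swapIn (K : Set ι) (x y : ∀ i, α i) :
    swapIn K (swapIn K x y) (swapIn K y x) = x := by
  funext i
  by_cases h : i ∈ K
  · rw [swapIn_of_mem h, swapIn_of_mem h]
  · rw [swapIn_of_notMem h, swapIn_of_notMem h]

/-- The exchange of the coordinates in `K` between the two components of a pair. -/
noncomputable def swapEquiv (K : Set ι) : ((∀ i, α i) × (∀ i, α i)) ≃ ((∀ i, α i) × (∀ i, α i)) :=
  Function.Involutive.toPerm (fun p => (swapIn K p.1 p.2, swapIn K p.2 p.1))
    fun p => Prod.ext (swapIn_swapIn K p.1 p.2) (swapIn_swapIn K p.2 p.1)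

theorem swapEquiv_apply (p : (∀ i, α i) × (∀ i, α i)) :
    swapEquiv K p = (swapIn K p.1 p.2, swapIn K p.2 p.1) := rfl

variable [∀ i, MeasurableSpace (α i)]

theorem measurable_swapIn (K : Set ι) :
    Measurable fun p : (∀ i, α i) × (∀ i, α i) => swapIn K p.1 p.2 := by
  refine measurable_pi_lambda _ fun i => ?_
  by_cases h : i ∈ K
  · simp only [swapIn_of_mem h]
    fun_prop
  · simp only [swapIn_of_notMem h]
    fun_prop

theorem measurePreserving_swapEquiv [Fintype ι] (μ : ∀ i, Measure (α i))
    [∀ i, IsProbabilityMeasure (μ i)] (K : Set ι) :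
    MeasurePreserving (swapEquiv K) ((Measure.pi μ).prod (Measure.pi μ))
      ((Measure.pi μ).prod (Measure.pi μ)) := by
  have hm : Measurable (swapEquiv K : ((∀ i, α i) × (∀ i, α i)) → _) :=
    (measurable_swapIn K).prodMk ((measurable_swapIn K).comp measurable_swap)
  refine ⟨hm, ?_⟩
  have hspan : (Measure.pi μ).FiniteSpanningSetsIn
      (Set.univ.pi '' Set.univ.pi fun i => {s : Set (α i) | MeasurableSet s}) :=
    { set := fun _ => Set.univ
      set_mem := fun _ => ⟨fun _ => Set.univ, by simp, by simp⟩
      finite := fun _ => measure_lt_top _ _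
      spanning := Set.iUnion_const _ }
  symm
  refine Measure.prod_eq_generateFrom generateFrom_pi generateFrom_pi
    isPiSystem_pi isPiSystem_pi hspan hspan ?_
  rintro _ ⟨s, hs, rfl⟩ _ ⟨r, hr, rfl⟩
  simp only [Set.mem_pi, Set.mem_univ, Set.mem_ofPred_eq, forall_true_left] at hs hr
  have hpre : swapEquiv K ⁻¹' ((Set.univ.pi s) ×ˢ (Set.univ.pi r)) =
      (Set.univ.pi (swapIn K s r)) ×ˢ (Set.univ.pi (swapIn K r s)) := by
    ext p
    simp only [Set.mem_preimage, swapEquiv_apply, Set.mem_prod, Set.mem_pi, Set.mem_univ,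
      forall_true_left, ← forall_and]
    refine forall_congr' fun i => ?_
    by_cases h : i ∈ K
    · simp only [swapIn_of_mem h, and_comm]
    · simp only [swapIn_of_notMem h]
  rw [Measure.map_apply hm
    ((MeasurableSet.univ_pi hs).prod (MeasurableSet.univ_pi hr)), hpre, Measure.prod_prod]
  simp only [Measure.pi_pi, ← Finset.prod_mul_distrib]
  refine Finset.prod_congr rfl fun i _ => ?_
  by_cases h : i ∈ K
  · simp only [swapIn_of_mem h, mul_comm]
  · simp only [swapIn_of_notMem h]

end Swap

section SwapSum

variable {V U : Type*} {X : V → Type*} {Ω : U → Type*} {K : Set (V ⊕ U)}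
  {x x' : ∀ v, X v} {ω ω' : ∀ u, Ω u} {v : V} {u : U}

theorem swapIn_inl_of_mem (h : Sum.inl v ∈ K) : swapIn (Sum.inl ⁻¹' K) x x' v = x' v :=
  swapIn_of_mem h

theorem swapIn_inl_of_notMem (h : Sum.inl v ∉ K) : swapIn (Sum.inl ⁻¹' K) x x' v = x v :=
  swapIn_of_notMem h

theorem swapIn_inr_of_mem (h : Sum.inr u ∈ K) : swapIn (Sum.inr ⁻¹' K) ω ω' u = ω' u :=
  swapIn_of_mem h

theorem swapIn_inr_of_notMem (h : Sum.inr u ∉ K) : swapIn (Sum.inr ⁻¹' K) ω ω' u = ω u :=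
  swapIn_of_notMem h

end SwapSum

/-! ### Sums of products of kernels -/

section WeightedMass

variable {V U : Type*} [Fintype V] {X : V → Type*} {Ω : U → Type*} [∀ u, MeasurableSpace (Ω u)]

/-- The total mass of `g` under the (unnormalized) law of the observed
variables that is the mixture over `μ` of the products of the kernels `f v`. -/
noncomputable def weightedMass (μ : Measure (∀ u, Ω u))
    (f : V → (∀ v, X v) → (∀ u, Ω u) → ℝ≥0∞) (g : (∀ v, X v) → ℝ≥0∞) : ℝ≥0∞ :=
  ∫⁻ ω, ∑' x, g x * ∏ v, f v x ω ∂μ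

variable [∀ v, Countable (X v)] {f f' : V → (∀ v, X v) → (∀ u, Ω u) → ℝ≥0∞}

theorem weightedMass_eq_tsum (μ : Measure (∀ u, Ω u)) (hf : ∀ v x, Measurable (f v x))
    (g : (∀ v, X v) → ℝ≥0∞) :
    weightedMass μ f g = ∑' x, g x * ∫⁻ ω, ∏ v, f v x ω ∂μ := by
  have hm : ∀ x, Measurable fun ω => ∏ v, f v x ω := fun x =>
    Finset.measurable_fun_prod _ fun v _ => hf v x
  rw [weightedMass, lintegral_tsum fun x => ((hm x).const_mul _).aemeasurable]
  exact tsum_congr fun x => lintegral_const_mul _ (hm x)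

/-- Exchange of coordinates in the product of two masses: if exchanging the coordinates in `K`
between two copies of all variables turns the product of the integrands on the left into that on
the right, then the products of the masses agree. -/
theorem weightedMass_mul_swap [Fintype U] (μ : ∀ u, Measure (Ω u))
    [∀ u, IsProbabilityMeasure (μ u)] (K : Set (V ⊕ U))
    (hf : ∀ v x, Measurable (f v x)) (hf' : ∀ v x, Measurable (f' v x))
    {g g' h h' : (∀ v, X v) → ℝ≥0∞}
    (hswap : ∀ x x' ω ω', (g x * ∏ v, f v x ω) * (g' x' * ∏ v, f' v x' ω') =
      (h (swapIn (Sum.inl ⁻¹' K) x x') *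
        ∏ v, f v (swapIn (Sum.inl ⁻¹' K) x x') (swapIn (Sum.inr ⁻¹' K) ω ω')) *
      (h' (swapIn (Sum.inl ⁻¹' K) x' x) *
        ∏ v, f' v (swapIn (Sum.inl ⁻¹' K) x' x) (swapIn (Sum.inr ⁻¹' K) ω' ω))) :
    weightedMass (Measure.pi μ) f g * weightedMass (Measure.pi μ) f' g' =
      weightedMass (Measure.pi μ) f h * weightedMass (Measure.pi μ) f' h' := by
  have hm : ∀ {f : V → (∀ v, X v) → (∀ u, Ω u) → ℝ≥0∞}, (∀ v x, Measurable (f v x)) →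
      ∀ (g : (∀ v, X v) → ℝ≥0∞) x, Measurable fun ω => g x * ∏ v, f v x ω := fun hf g x =>
    (Finset.measurable_fun_prod _ fun v _ => hf v x).const_mul _
  have hprod : ∀ g g' : (∀ v, X v) → ℝ≥0∞,
      weightedMass (Measure.pi μ) f g * weightedMass (Measure.pi μ) f' g' =
      ∫⁻ q, ∑' p : (∀ v, X v) × (∀ v, X v), (g p.1 * ∏ v, f v p.1 q.1) *
        (g' p.2 * ∏ v, f' v p.2 q.2) ∂((Measure.pi μ).prod (Measure.pi μ)) := by
    intro g g'
    rw [weightedMass, weightedMass, ← lintegral_prod_mul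
      (Measurable.tsum (hm hf g)).aemeasurable
      (Measurable.tsum (hm hf' g')).aemeasurable]
    refine lintegral_congr fun q => ?_
    rw [ENNReal.tsum_prod', ← ENNReal.tsum_mul_right]
    exact tsum_congr fun x => ENNReal.tsum_mul_left.symm
  rw [hprod, hprod]
  symm
  rw [← (measurePreserving_swapEquiv μ (Sum.inr ⁻¹' K)).lintegral_comp]
  · refine lintegral_congr fun q => ?_
    rw [← (swapEquiv (α := X) (Sum.inl ⁻¹' K)).tsum_eq]
    exact tsum_congr fun p => (hswap _ _ _ _).symm
  · exact Measurable.tsum fun p => ((hm hf h p.1).comp measurable_fst).mul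
      ((hm hf' h' p.2).comp measurable_snd)

end WeightedMass

/-! ### Marginalizing over descendants -/

section Freeze

variable {V : Type*} {X : V → Type*}

open Classical in
/-- A normalized kernel at `v` may be replaced by the point mass at `a₀`, if nothing else depends
on the coordinate `v`. -/
theorem tsum_mul_kernel_eq [DecidableEq V] {v : V} (F f : (∀ v, X v) → ℝ≥0∞) (a₀ : X v)
    (hF : ∀ x a, F (Function.update x v a) = F x)
    (hf : ∀ x, ∑' a, f (Function.update x v a) = 1) :
    ∑' x, F x * f x = ∑' x, F x * (if x v = a₀ then 1 else 0) := by
  -- `(x, a) ↦ (x with a at v, x v)` reindexes the double sum over `x` and a spare value `a`.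
  let e : ((∀ v, X v) × X v) ≃ ((∀ v, X v) × X v) :=
    Function.Involutive.toPerm (fun p => (Function.update p.1 v p.2, p.1 v))
      fun p => by simp
  have he : ∀ p, e p = (Function.update p.1 v p.2, p.1 v) := fun _ => rfl
  calc ∑' x, F x * f x
      = ∑' p : (∀ v, X v) × X v, F p.1 * f p.1 * (if p.2 = a₀ then 1 else 0) := by
        rw [ENNReal.tsum_prod']
        exact tsum_congr fun x => by
          simp only [ENNReal.tsum_mul_left, tsum_ite_eq, mul_one]
    _ = ∑' p : (∀ v, X v) × X v, F p.1 * (if p.1 v = a₀ then 1 else 0) *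
          f (Function.update p.1 v p.2) := by
        rw [← e.tsum_eq]
        refine tsum_congr fun p => ?_
        rw [he, hF, mul_right_comm]
    _ = ∑' x, F x * (if x v = a₀ then 1 else 0) := by
        rw [ENNReal.tsum_prod']
        exact tsum_congr fun x => by
          change ∑' b, (F x * if x v = a₀ then 1 else 0) * f (Function.update x v b) = _
          rw [ENNReal.tsum_mul_left, hf, mul_one]

variable {W : Type*}

open Classical in
/-- The family of kernels `f` with those of the vertices in `D` replaced by the point masses at the
coordinates of `x₀`. -/
noncomputable def freeze (D : Finset V) (x₀ : ∀ v, X v) (f : V → (∀ v, X v) → W → ℝ≥0∞) :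
    V → (∀ v, X v) → W → ℝ≥0∞ :=
  fun v x ω => if v ∈ D then (if x v = x₀ v then 1 else 0) else f v x ω

theorem freeze_of_notMem {D : Finset V} {x₀ : ∀ v, X v} {f : V → (∀ v, X v) → W → ℝ≥0∞} {v : V}
    (h : v ∉ D) : freeze D x₀ f v = f v := by
  funext x ω
  simp [freeze, h]

theorem freeze_congr {D : Finset V} {x₀ : ∀ v, X v} {f : V → (∀ v, X v) → W → ℝ≥0∞} {v : V}
    (h : v ∈ D) {x x' : ∀ v, X v} (hx : x v = x' v) (ω ω' : W) :
    freeze D x₀ f v x ω = freeze D x₀ f v x' ω' := by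
  unfold freeze
  rw [if_pos h, if_pos h, hx]

/-- Let `D` be such that neither `g` nor a kernel outside `D` depends on the coordinates in `D`,
and such that `D` can be exhausted by removing sinks. Then the kernels in `D` can be frozen. -/
theorem tsum_mul_prod_freeze [Fintype V] [DecidableEq V] (x₀ : ∀ v, X v)
    (g : (∀ v, X v) → ℝ≥0∞) (ω : W) (D : Finset V) :
    ∀ f : V → (∀ v, X v) → W → ℝ≥0∞,
    (∀ v ∈ D, ∀ x a, g (Function.update x v a) = g x) →
    (∀ w ∉ D, ∀ v ∈ D, ∀ x a, f w (Function.update x v a) ω = f w x ω) →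
    (∀ D' ⊆ D, D'.Nonempty → ∃ v ∈ D', ∀ w ∈ D', w ≠ v → ∀ x a,
      f w (Function.update x v a) ω = f w x ω) →
    (∀ v ∈ D, ∀ x, ∑' a, f v (Function.update x v a) ω = 1) →
    ∑' x, g x * ∏ v, f v x ω = ∑' x, g x * ∏ v, freeze D x₀ f v x ω := by
  induction D using Finset.strongInduction with
  | H D ih =>
  intro f hg hout hsink hnorm
  rcases D.eq_empty_or_nonempty with rfl | hD
  · simp [freeze]
  obtain ⟨v, hv, hvs⟩ := hsink D subset_rfl hD
  -- The kernel of the sink `v` is frozen first.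
  have h1 : ∑' x, g x * ∏ w, f w x ω = ∑' x, g x * ∏ w, freeze {v} x₀ f w x ω := by
    have hsplit : ∀ (f : V → (∀ v, X v) → W → ℝ≥0∞) x,
        g x * ∏ w, f w x ω = (g x * ∏ w ∈ Finset.univ.erase v, f w x ω) * f v x ω := by
      intro f x
      rw [mul_assoc, Finset.prod_erase_mul _ _ (Finset.mem_univ v)]
    simp_rw [hsplit]
    rw [tsum_mul_kernel_eq (v := v) _ _ (x₀ v) _ (hnorm v hv)]
    · refine tsum_congr fun x => ?_
      congr 1
      · congr 1
        refine Finset.prod_congr rfl fun w hw => ?_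
        rw [freeze_of_notMem (by simpa using (Finset.mem_erase.1 hw).1)]
      · simp [freeze]
    · intro x a
      rw [hg v hv]
      congr 1
      refine Finset.prod_congr rfl fun w hw => ?_
      by_cases hwD : w ∈ D
      · exact hvs w hwD (Finset.mem_erase.1 hw).1 x a
      · exact hout w hwD v hv x a
  have hne : ∀ w ∈ D.erase v, w ≠ v := fun w hw => (Finset.mem_erase.1 hw).1
  rw [h1, ih (D.erase v) (Finset.erase_ssubset hv) (freeze {v} x₀ f)]
  · refine tsum_congr fun x => ?_
    congr 1
    refine Finset.prod_congr rfl fun w _ => ?_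
    by_cases hwv : w = v
    · subst hwv
      simp [freeze, hv]
    · simp [freeze, hwv]
  · exact fun w hw => hg w (Finset.mem_of_mem_erase hw)
  · intro w hw w' hw' x a
    by_cases hwv : w = v
    · exact freeze_congr (by simp [hwv])
        (Function.update_of_ne (by rw [hwv]; exact (hne w' hw').symm) _ _) _ _
    · rw [freeze_of_notMem (by simpa using hwv)]
      exact hout w (fun h => hw (Finset.mem_erase.2 ⟨hwv, h⟩)) w' (Finset.mem_of_mem_erase hw') x a
  · intro D' hD' hne'
    obtain ⟨w, hw, hws⟩ := hsink D' (hD'.trans (Finset.erase_subset _ _)) hne'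
    refine ⟨w, hw, fun w' hw' hww x a => ?_⟩
    rw [freeze_of_notMem (by simpa using hne w' (hD' hw'))]
    exact hws w' hw' hww x a
  · intro w hw x
    rw [freeze_of_notMem (by simpa using hne w hw)]
    exact hnorm w (Finset.mem_of_mem_erase hw) x

end Freeze

/-! ### Masses of events -/

section Mass

variable {α β : Type*} (P : α → ℝ≥0∞)

theorem massOf_mono {A B : Set α} (h : A ⊆ B) : massOf P A ≤ massOf P B :=
  ENNReal.tsum_le_tsum fun x => Set.indicator_le_indicator_of_subset h (fun _ => zero_le) x

theorem massOf_eq_tsum_fiber (A : Set α) (φ : α → β) :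
    massOf P A = ∑' b, massOf P (A ∩ {x | φ x = b}) := by
  simp only [massOf]
  rw [ENNReal.tsum_comm]
  refine tsum_congr fun x => ?_
  rw [tsum_eq_single (φ x)]
  · by_cases h : x ∈ A <;> simp [h]
  · intro b hb
    simp [hb.symm]

theorem indicator_one_congr {A A' : Set α} {x x' : α} (h : x ∈ A ↔ x' ∈ A') :
    A.indicator (1 : α → ℝ≥0∞) x = A'.indicator 1 x' := by
  by_cases hx : x ∈ A
  · simp [hx, h.1 hx]
  · simp [hx, mt h.2 hx]

theorem indicator_one_mul_congr {A B A' B' : Set α} {x x' z z' : α}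
    (h : x ∈ A ∧ x' ∈ B ↔ z ∈ A' ∧ z' ∈ B') :
    A.indicator (1 : α → ℝ≥0∞) x * B.indicator 1 x' = A'.indicator 1 z * B'.indicator 1 z' := by
  by_cases h1 : x ∈ A <;> by_cases h2 : x' ∈ B <;> by_cases h3 : z ∈ A' <;>
    by_cases h4 : z' ∈ B' <;> simp_all

theorem mem_evVar {V : Type*} {X : V → Type*} {v : V} {a : X v} {x : ∀ v, X v} :
    x ∈ evVar v a ↔ x v = a := Iff.rfl

theorem mem_evSet {V : Type*} {X : V → Type*} {S : Finset V} {s : ∀ v : S, X v} {x : ∀ v, X v} :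
    x ∈ evSet S s ↔ ∀ v : S, x v = s v := Iff.rfl

end Mass

/-! ### Kernel families on a causal graph -/

section KernelFamily

variable {V U : Type*} {X : V → Type*} {Ω : U → Type*}

theorem CausalGraph.exists_sink [Finite V] (G : CausalGraph V U) {D : Finset V} (hD : D.Nonempty) :
    ∃ v ∈ D, ∀ w ∈ D, ¬ G.Edge (Sum.inl v) (Sum.inl w) := by
  let r : V → V → Prop := fun a b => Relation.TransGen G.Edge (Sum.inl b) (Sum.inl a)
  have htrans : IsTrans V r := ⟨fun _ _ _ h1 h2 => h2.trans h1⟩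
  have hirrefl : Std.Irrefl r := ⟨fun a => G.acyclic (Sum.inl a)⟩
  obtain ⟨v, hv, h⟩ := (Finite.wellFounded_of_trans_of_irrefl r).has_min (D : Set V) hD
  exact ⟨v, hv, fun w hw he => h w hw (.single he)⟩

/-- The family `f` is Markov with respect to the causal graph `G`, and normalized: `f v`
depends on `v` and its parents only, and is a probability mass function of the value at `v`. -/
structure IsKernelFamily [DecidableEq V] (G : CausalGraph V U)
    (f : V → (∀ v, X v) → (∀ u, Ω u) → ℝ≥0∞) : Prop where
  congr : ∀ {v x x' ω ω'}, x v = x' v →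
    (∀ a, G.Edge (Sum.inl a) (Sum.inl v) → x a = x' a) →
    (∀ u, G.Edge (Sum.inr u) (Sum.inl v) → ω u = ω' u) → f v x ω = f v x' ω'
  norm : ∀ v x ω, ∑' a, f v (Function.update x v a) ω = 1

variable [∀ u, MeasurableSpace (Ω u)] {f : V → (∀ v, X v) → (∀ u, Ω u) → ℝ≥0∞}

theorem measurable_freeze (hf : ∀ v x, Measurable (f v x)) (D : Finset V) (x₀ : ∀ v, X v) :
    ∀ v x, Measurable (freeze D x₀ f v x) := by
  intro v x
  by_cases h : v ∈ D
  · have : ∀ ω ω', freeze D x₀ f v x ω = freeze D x₀ f v x ω' := freeze_congr h rfl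
    exact measurable_const' this
  · rw [freeze_of_notMem h]
    exact hf v x

variable [Fintype V] {G : CausalGraph V U}

theorem IsKernelFamily.weightedMass_freeze [DecidableEq V] (hf : IsKernelFamily G f)
    (μ : Measure (∀ u, Ω u))
    (D : Finset V) (x₀ : ∀ v, X v) {E : Set (∀ v, X v)}
    (hE : ∀ x x', (∀ v ∉ D, x v = x' v) → (x ∈ E ↔ x' ∈ E))
    (hD : ∀ w ∉ D, ∀ v ∈ D, ∀ x a ω, f w (Function.update x v a) ω = f w x ω) :
    weightedMass μ f (E.indicator 1) = weightedMass μ (freeze D x₀ f) (E.indicator 1) := by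
  refine lintegral_congr fun ω => tsum_mul_prod_freeze x₀ _ ω D f ?_ ?_ ?_ ?_
  · exact fun v hv x a => indicator_one_congr (hE _ _ fun w hw =>
      Function.update_of_ne (ne_of_mem_of_not_mem hv hw).symm _ _)
  · exact fun w hw v hv x a => hD w hw v hv x a ω
  · intro D' _ hne
    obtain ⟨v, hv, h⟩ := G.exists_sink hne
    exact ⟨v, hv, fun w hw hwv x a => hf.congr (Function.update_of_ne hwv _ _)
      (fun b hb => Function.update_of_ne (by rintro rfl; exact h w hw hb) _ _) fun _ _ => rfl⟩
  · exact fun v _ x => hf.norm v x ω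

theorem IsKernelFamily.weightedMass_univ [DecidableEq V] (hf : IsKernelFamily G f)
    (μ : Measure (∀ u, Ω u))
    [IsProbabilityMeasure μ] (x₀ : ∀ v, X v) : weightedMass μ f (Set.univ.indicator 1) = 1 := by
  rw [hf.weightedMass_freeze μ Finset.univ x₀ (fun _ _ _ => Iff.rfl)
    fun w hw => (hw (Finset.mem_univ w)).elim, weightedMass]
  have h : ∀ ω, ∑' x, Set.univ.indicator (1 : (∀ v, X v) → ℝ≥0∞) x *
      ∏ v, freeze Finset.univ x₀ f v x ω = 1 := by
    intro ω
    rw [tsum_eq_single x₀]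
    · simp [freeze]
    · intro x hx
      obtain ⟨v, hv⟩ := Function.ne_iff.1 hx
      rw [Finset.prod_eq_zero (Finset.mem_univ v) (by simp [freeze, hv]), mul_zero]
  rw [lintegral_congr h, lintegral_one, measure_univ]

end KernelFamily

/-! ### The single-world intervention model -/

namespace SMCM

variable {V U : Type*} {X : V → Type*} {Ω : U → Type*} [∀ u, MeasurableSpace (Ω u)]
  (M : SMCM V U X Ω)

instance (u : U) : IsProbabilityMeasure (M.law u) := M.law_prob u

theorem measurable_factor (v : V) (x : ∀ v, X v) : Measurable (M.factor v x) :=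
  (M.measurable_mech v _ _).comp (by fun_prop)

theorem factor_congr {v : V} {x x' : ∀ v, X v} {ω ω' : ∀ u, Ω u} (hv : x v = x' v)
    (hx : ∀ a, M.graph.Edge (Sum.inl a) (Sum.inl v) → x a = x' a)
    (hω : ∀ u, M.graph.Edge (Sum.inr u) (Sum.inl v) → ω u = ω' u) :
    M.factor v x ω = M.factor v x' ω' := by
  have h1 : (fun a : M.graph.ObsParent v => x a.1) = fun a : M.graph.ObsParent v => x' a.1 :=
    funext fun a => hx a.1 a.2
  have h2 : (fun u : M.graph.LatParent v => ω u.1) = fun u : M.graph.LatParent v => ω' u.1 :=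
    funext fun u => hω u.1 u.2
  simp only [factor, h1, h2, hv]

theorem massOf_obsDist [Fintype V] [Fintype U] [∀ v, Countable (X v)] (A : Set (∀ v, X v)) :
    massOf M.obsDist A = weightedMass (Measure.pi M.law) M.factor (A.indicator 1) := by
  rw [weightedMass_eq_tsum _ M.measurable_factor]
  refine tsum_congr fun x => ?_
  by_cases h : x ∈ A <;> simp [h, obsDist]

variable [DecidableEq V]

theorem tsum_factor (v : V) (x : ∀ v, X v) (ω : ∀ u, Ω u) :
    ∑' a, M.factor v (Function.update x v a) ω = 1 := by
  rw [← (M.mech v (fun a => x a.1) fun u => ω u.1).tsum_coe]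
  refine tsum_congr fun a => ?_
  have h1 : (fun b : M.graph.ObsParent v => Function.update x v a b.1) =
      fun b : M.graph.ObsParent v => x b.1 := funext fun b => Function.update_of_ne
        (fun h => CausalGraph.ne_of_edge b.2 (congrArg _ h)) _ _
  simp only [factor, h1, Function.update_self]

/-- The kernels of the single-world intervention model: `T` follows its own mechanism, whereas the
children of `T` respond to the value `t` in place of the value of `T`. -/
noncomputable def swigKernel (T : V) (t : X T) (v : V) (x : ∀ v, X v) (ω : ∀ u, Ω u) : ℝ≥0∞ :=
  if v = T then M.factor v x ω else M.factor v (Function.update x T t) ω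

variable {T : V} {t : X T}

theorem swigKernel_of_ne {v : V} (h : v ≠ T) (x : ∀ v, X v) (ω : ∀ u, Ω u) :
    M.swigKernel T t v x ω = M.factor v (Function.update x T t) ω := if_neg h

theorem measurable_swigKernel (v : V) (x : ∀ v, X v) : Measurable (M.swigKernel T t v x) := by
  unfold swigKernel
  split_ifs
  · exact M.measurable_factor v x
  · exact M.measurable_factor v _

theorem swigKernel_congr {v : V} {x x' : ∀ v, X v} {ω ω' : ∀ u, Ω u} (hv : x v = x' v)
    (hx : ∀ a, a ≠ T → M.graph.Edge (Sum.inl a) (Sum.inl v) → x a = x' a)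
    (hω : ∀ u, M.graph.Edge (Sum.inr u) (Sum.inl v) → ω u = ω' u) :
    M.swigKernel T t v x ω = M.swigKernel T t v x' ω' := by
  unfold swigKernel
  split_ifs with h
  · exact M.factor_congr hv (fun a ha => hx a
      (fun h' => CausalGraph.ne_of_edge ha (by rw [h', h])) ha) hω
  · refine M.factor_congr ?_ (fun a ha => ?_) hω
    · simpa [h] using hv
    · by_cases haT : a = T
      · subst haT
        simp
      · simpa [haT] using hx a haT ha

/-- The two families differ only in the response of the children of `T` to the value of `T`. -/
theorem swigKernel_eq_factor {v : V} (x : ∀ v, X v) (ω : ∀ u, Ω u)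
    (h : M.graph.Edge (Sum.inl T) (Sum.inl v) → x T = t) :
    M.swigKernel T t v x ω = M.factor v x ω := by
  unfold swigKernel
  split_ifs with hv
  · rfl
  · refine M.factor_congr (Function.update_of_ne hv _ _) (fun a ha => ?_) fun _ _ => rfl
    by_cases haT : a = T
    · subst haT
      simp [h ha]
    · exact Function.update_of_ne haT _ _

theorem isKernelFamily_factor [Fintype V] : IsKernelFamily M.graph M.factor :=
  ⟨M.factor_congr, M.tsum_factor⟩

theorem isKernelFamily_swigKernel [Fintype V] : IsKernelFamily M.graph (M.swigKernel T t) where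
  congr hv hx hω := M.swigKernel_congr hv (fun a _ => hx a) hω
  norm v x ω := by
    by_cases h : v = T
    · simp only [swigKernel, h, if_true]
      subst h
      exact M.tsum_factor v x ω
    · simp only [swigKernel_of_ne M h, Function.update_comm h]
      exact M.tsum_factor v _ ω

variable [Fintype V] [Fintype U]

/-- The law of the observed variables in the single-world intervention model. -/
noncomputable def swigDist (T : V) (t : X T) (x : ∀ v, X v) : ℝ≥0∞ :=
  ∫⁻ ω, ∏ v, M.swigKernel T t v x ω ∂(Measure.pi M.law)

/-- Consistency: on the event that `T` takes the value `t`, feeding `t` to the children of `T`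
changes nothing. -/
theorem massOf_swigDist_inter_evVar (A : Set (∀ v, X v)) :
    massOf (M.swigDist T t) (A ∩ evVar T t) = massOf M.obsDist (A ∩ evVar T t) := by
  refine tsum_congr fun x => ?_
  by_cases h : x ∈ A ∩ evVar T t
  · have hx : x T = t := h.2
    rw [Set.indicator_of_mem h, Set.indicator_of_mem h, swigDist, obsDist]
    exact lintegral_congr fun ω =>
      Finset.prod_congr rfl fun v _ => M.swigKernel_eq_factor x ω fun _ => hx
  · rw [Set.indicator_of_notMem h, Set.indicator_of_notMem h]

variable [∀ v, Countable (X v)]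

theorem massOf_swigDist (A : Set (∀ v, X v)) :
    massOf (M.swigDist T t) A =
      weightedMass (Measure.pi M.law) (M.swigKernel T t) (A.indicator 1) := by
  rw [weightedMass_eq_tsum _ M.measurable_swigKernel]
  refine tsum_congr fun x => ?_
  by_cases h : x ∈ A <;> simp [h, swigDist]

theorem massOf_obsDist_ne_top (x₀ : ∀ v, X v) (A : Set (∀ v, X v)) :
    massOf M.obsDist A ≠ ∞ := by
  refine ne_top_of_le_ne_top ENNReal.one_ne_top
    ((massOf_mono _ (Set.subset_univ A)).trans_eq ?_)
  rw [massOf_obsDist]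
  exact M.isKernelFamily_factor.weightedMass_univ _ x₀

theorem causalEffect_eq_massOf_swigDist (x₀ : ∀ v, X v) {Y : V} (hYT : Y ≠ T) (y : X Y) :
    M.causalEffect T Y t y = massOf (M.swigDist T t) (evVar Y y) := by
  rw [massOf_swigDist, M.isKernelFamily_swigKernel.weightedMass_freeze _ {T}
    (Function.update x₀ T t),
    weightedMass_eq_tsum _ (measurable_freeze M.measurable_swigKernel _ _)]
  · refine tsum_congr fun x => ?_
    have hdo : M.doDist T t x = ∫⁻ ω, ∏ v, freeze {T} (Function.update x₀ T t)
        (M.swigKernel T t) v x ω ∂(Measure.pi M.law) := by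
      by_cases hx : x T = t
      · rw [doDist, if_pos hx]
        refine lintegral_congr fun ω => ?_
        rw [← Finset.mul_prod_erase _ _ (Finset.mem_univ T)]
        have h1 : freeze {T} (Function.update x₀ T t) (M.swigKernel T t) T x ω = 1 := by
          simp [freeze, hx]
        rw [h1, one_mul]
        refine Finset.prod_congr (by congr!) fun v hv => ?_
        rw [freeze_of_notMem (by simpa using (Finset.mem_erase.1 hv).1)]
        exact (M.swigKernel_eq_factor x ω fun _ => hx).symm
      · rw [doDist, if_neg hx]
        symm
        have h0 : ∀ ω, ∏ v, freeze {T} (Function.update x₀ T t) (M.swigKernel T t) v x ω = 0 :=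
          fun ω => Finset.prod_eq_zero (Finset.mem_univ T) (by simp [freeze, hx])
        simp [h0]
    by_cases h : x ∈ evVar Y y <;> simp [h, hdo]
  · intro x x' h
    simp only [mem_evVar, h Y (by simpa using hYT)]
  · intro w hw v hv x a ω
    rw [Finset.mem_singleton] at hw hv
    subst hv
    rw [swigKernel_of_ne M hw, swigKernel_of_ne M hw, Function.update_idem]


/-! ### The two independence statements -/

open Relation

/-- Feeding `t` to the children of `T` does not change the law of `T` itself, because only ancestors
of `T` matter. -/
theorem massOf_swigDist_evVar_self (x₀ : ∀ v, X v) (t' : X T) :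
    massOf (M.swigDist T t) (evVar T t') = massOf M.obsDist (evVar T t') := by
  classical
  let D : Finset V := {v | ¬ ReflTransGen M.graph.Edge (Sum.inl v) (Sum.inl T)}
  have hD : ∀ v, v ∉ D ↔ ReflTransGen M.graph.Edge (Sum.inl v) (Sum.inl T) := by simp [D]
  have hg : ∀ x x' : ∀ v, X v, (∀ v ∉ D, x v = x' v) →
      (x ∈ evVar T t' ↔ x' ∈ evVar T t') := fun x x' h => by
    simp only [mem_evVar, h T ((hD T).2 .refl)]
  have hpar : ∀ w ∉ D, ∀ v ∈ D, v ≠ w ∧ ¬ M.graph.Edge (Sum.inl v) (Sum.inl w) :=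
    fun w hw v hv => ⟨ne_of_mem_of_not_mem hv hw,
      fun he => (hD v).2 (((hD w).1 hw).head he) hv⟩
  rw [massOf_swigDist, massOf_obsDist,
    M.isKernelFamily_swigKernel.weightedMass_freeze _ D x₀ hg,
    M.isKernelFamily_factor.weightedMass_freeze _ D x₀ hg]
  · congr 1
    funext v x ω
    by_cases hv : v ∈ D
    · exact (freeze_congr hv rfl ω ω).trans (by simp [freeze, hv])
    · rw [freeze_of_notMem hv, freeze_of_notMem hv]
      refine M.swigKernel_eq_factor x ω fun he => ?_
      exact (M.graph.acyclic _ (TransGen.head' he ((hD v).1 hv))).elim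
  · exact fun w hw v hv x a ω => M.factor_congr
      (Function.update_of_ne (hpar w hw v hv).1.symm _ _)
      (fun b hb => Function.update_of_ne (by rintro rfl; exact (hpar w hw b hv).2 hb) _ _)
      fun _ _ => rfl
  · exact fun w hw v hv x a ω => M.swigKernel_congr
      (Function.update_of_ne (hpar w hw v hv).1.symm _ _)
      (fun b _ hb => Function.update_of_ne (by rintro rfl; exact (hpar w hw b hv).2 hb) _ _)
      fun _ _ => rfl

/-- If `S` and `T` have no common ancestor after the edges out of `T` are deleted, then `S` and `T`
are independent in the single-world intervention model: the coordinates of the ancestors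
of `T` can be exchanged between two independent copies. -/
theorem massOf_swigDist_evSet_inter_evVar (x₀ : ∀ v, X v) {S : Finset V}
    (hS : ∀ a w, ReflTransGen M.graph.Edge a (Sum.inl T) →
      ReflTransGen (M.graph.EdgeAvoiding T) a w → w ∉ CausalGraph.obs S)
    (s : ∀ v : S, X v) (t' : X T) :
    massOf (M.swigDist T t) (evSet S s ∩ evVar T t') =
      massOf (M.swigDist T t) (evSet S s) * massOf M.obsDist (evVar T t') := by
  classical
  let K : Set (V ⊕ U) := {w | ReflTransGen M.graph.Edge w (Sum.inl T)}
  let A : Set (V ⊕ U) := {w | ∃ v ∈ S, ReflTransGen (M.graph.EdgeAvoiding T) w (Sum.inl v)}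
  have hKA : ∀ w ∈ A, w ∉ K := fun w ⟨v, hv, hw⟩ hK =>
    hS w _ hK hw (CausalGraph.mem_obs.2 hv)
  have hTK : Sum.inl T ∈ K := ReflTransGen.refl
  have hK : ∀ {w v}, v ∈ K → M.graph.Edge w v → w ∈ K := fun hv he => ReflTransGen.head he hv
  have hA : ∀ {w v}, v ∈ A → M.graph.Edge w v → w ≠ Sum.inl T → w ∈ A :=
    fun ⟨v, hv, h⟩ he hne => ⟨v, hv, .head ⟨he, hne⟩ h⟩
  have hSA : ∀ v ∈ S, Sum.inl v ∈ A := fun v hv => ⟨v, hv, .refl⟩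
  let D : Finset V := {v | Sum.inl v ∉ K ∧ Sum.inl v ∉ A}
  have hD : ∀ v, v ∉ D ↔ Sum.inl v ∈ K ∨ Sum.inl v ∈ A := fun v => by
    simp only [D, Finset.mem_filter, Finset.mem_univ, true_and]
    tauto
  have hTD : T ∉ D := (hD T).2 (.inl hTK)
  have hSD : ∀ v : S, v.1 ∉ D := fun v => (hD _).2 (.inr (hSA v v.2))
  have hfreeze : ∀ {E : Set (∀ v, X v)}, (∀ x x', (∀ v ∉ D, x v = x' v) → (x ∈ E ↔ x' ∈ E)) →
      weightedMass (Measure.pi M.law) (M.swigKernel T t) (E.indicator 1) =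
        weightedMass (Measure.pi M.law) (freeze D x₀ (M.swigKernel T t)) (E.indicator 1) := by
    refine fun hE => M.isKernelFamily_swigKernel.weightedMass_freeze _ D x₀ hE ?_
    refine fun w hw v hv x a ω => M.swigKernel_congr
      (Function.update_of_ne (ne_of_mem_of_not_mem hv hw).symm _ _)
      (fun b hbT hb => Function.update_of_ne ?_ _ _) fun _ _ => rfl
    rintro rfl
    refine (hD b).2 (((hD w).1 hw).imp (fun h => hK h hb) fun h => hA h hb ?_) hv
    simpa using hbT
  have hgT : ∀ x x' : ∀ v, X v, (∀ v ∉ D, x v = x' v) → (x ∈ evVar T t' ↔ x' ∈ evVar T t') :=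
    fun x x' h => by simp only [mem_evVar, h T hTD]
  have hgS : ∀ x x' : ∀ v, X v, (∀ v ∉ D, x v = x' v) → (x ∈ evSet S s ↔ x' ∈ evSet S s) :=
    fun x x' h => by simp only [mem_evSet, fun v : S => h v (hSD v)]
  have hone := M.isKernelFamily_swigKernel (T := T) (t := t) |>.weightedMass_univ
    (Measure.pi M.law) x₀
  rw [← massOf_swigDist_evVar_self M (t := t) x₀, massOf_swigDist, massOf_swigDist,
    massOf_swigDist, ← mul_one (weightedMass _ _ ((evSet S s ∩ evVar T t').indicator 1)), ← hone,
    hfreeze (E := Set.univ) fun _ _ _ => Iff.rfl,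
    hfreeze (E := evSet S s ∩ evVar T t') fun x x' h => (hgS x x' h).and (hgT x x' h),
    hfreeze hgS, hfreeze hgT]
  have hm := measurable_freeze (M.measurable_swigKernel (T := T) (t := t)) D x₀
  refine weightedMass_mul_swap M.law K hm hm fun x x' ω ω' => ?_
  rw [mul_mul_mul_comm, mul_mul_mul_comm ((evSet S s).indicator 1 _), ← Finset.prod_mul_distrib,
    ← Finset.prod_mul_distrib]
  congr 1
  · have h1 : ∀ v : S, swapIn (Sum.inl ⁻¹' K) x x' v = x v := fun v =>
      swapIn_inl_of_notMem (hKA _ (hSA v v.2))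
    have h2 : swapIn (Sum.inl ⁻¹' K) x' x T = x T := swapIn_inl_of_mem hTK
    refine indicator_one_mul_congr ?_
    simp only [Set.mem_inter_iff, mem_evSet, mem_evVar, Set.mem_univ, and_true, h1, h2]
  · refine Finset.prod_congr rfl fun v _ => ?_
    by_cases hvK : Sum.inl v ∈ K
    · -- The kernels of the ancestors of `T` are exchanged between the copies.
      have hvD : v ∉ D := (hD v).2 (.inl hvK)
      rw [freeze_of_notMem hvD, mul_comm]
      congr 1
      · exact M.swigKernel_congr (swapIn_inl_of_mem hvK).symm
          (fun a _ ha => (swapIn_inl_of_mem (hK hvK ha)).symm)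
          fun u hu => (swapIn_inr_of_mem (hK hvK hu)).symm
      · exact M.swigKernel_congr (swapIn_inl_of_mem hvK).symm
          (fun a _ ha => (swapIn_inl_of_mem (hK hvK ha)).symm)
          fun u hu => (swapIn_inr_of_mem (hK hvK hu)).symm
    · by_cases hvD : v ∈ D
      · congr 1
        · exact freeze_congr hvD (swapIn_inl_of_notMem hvK).symm _ _
        · exact freeze_congr hvD (swapIn_inl_of_notMem hvK).symm _ _
      · have hvA : Sum.inl v ∈ A := ((hD v).1 hvD).resolve_left hvK
        rw [freeze_of_notMem hvD]
        congr 1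
        · exact M.swigKernel_congr (swapIn_inl_of_notMem hvK).symm
            (fun a haT ha => (swapIn_inl_of_notMem (hKA _ (hA hvA ha (by simpa using haT)))).symm)
            fun u hu => (swapIn_inr_of_notMem (hKA _ (hA hvA hu (by simp)))).symm
        · exact M.swigKernel_congr (swapIn_inl_of_notMem hvK).symm
            (fun a haT ha => (swapIn_inl_of_notMem (hKA _ (hA hvA ha (by simpa using haT)))).symm)
            fun u hu => (swapIn_inr_of_notMem (hKA _ (hA hvA hu (by simp)))).symm

/-- If the component of `Y` in the ancestral moral graph, after `{T} ∪ S` is deleted, contains no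
child of `T` and no parent of one, then the conditional law of `Y` given `S` and `T` does not depend
on the value that the children of `T` are fed. The product of the conditional laws is written
out, so that nothing is divided by zero. -/
theorem massOf_swigDist_mul_massOf_obsDist (x₀ : ∀ v, X v) {Y : V} {S : Finset V} (hYT : Y ≠ T)
    (hYS : Y ∉ S)
    (hcomp : ∀ v, M.graph.Edge (Sum.inl T) (Sum.inl v) →
      ¬ (Sum.inl v ∈ M.graph.comp (CausalGraph.obs ({T} ∪ S)) (Sum.inl Y) ∨
        ∃ w ∈ M.graph.comp (CausalGraph.obs ({T} ∪ S)) (Sum.inl Y), M.graph.Edge w (Sum.inl v)))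
    (s : ∀ v : S, X v) (t' : X T) (y : X Y) :
    massOf (M.swigDist T t) (evVar Y y ∩ (evSet S s ∩ evVar T t')) *
        massOf M.obsDist (evSet S s ∩ evVar T t') =
      massOf (M.swigDist T t) (evSet S s ∩ evVar T t') *
        massOf M.obsDist (evVar Y y ∩ (evSet S s ∩ evVar T t')) := by
  classical
  let C : Set (V ⊕ U) := CausalGraph.obs ({T} ∪ S)
  let K : Set (V ⊕ U) := M.graph.comp C (Sum.inl Y)
  have hTC : Sum.inl T ∈ C := CausalGraph.mem_obs.2 (by simp)
  have hSC : ∀ v ∈ S, Sum.inl v ∈ C := fun v hv => CausalGraph.mem_obs.2 (by simp [hv])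
  have hYC : Sum.inl Y ∉ C := by simp [C, CausalGraph.mem_obs, hYT, hYS]
  have hYK : Sum.inl Y ∈ K := ⟨.inr .refl, hYC, false, .start⟩
  have hKC : ∀ w ∈ C, w ∉ K := fun w hw hK => hK.2.1 hw
  have hCA : ∀ w ∈ C, M.graph.Anc C (Sum.inl Y) w := fun w hw => .inl ⟨w, hw, .refl⟩
  let D : Finset V := {v | ¬ M.graph.Anc C (Sum.inl Y) (Sum.inl v)}
  have hD : ∀ v, v ∉ D ↔ M.graph.Anc C (Sum.inl Y) (Sum.inl v) := by simp [D]
  have hTD : T ∉ D := (hD T).2 (hCA _ hTC)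
  have hYD : Y ∉ D := (hD Y).2 (.inr .refl)
  have hSD : ∀ v : S, v.1 ∉ D := fun v => (hD _).2 (hCA _ (hSC v v.2))
  have hpar : ∀ w ∉ D, ∀ v ∈ D, ¬ M.graph.Edge (Sum.inl v) (Sum.inl w) :=
    fun w hw v hv he => (hD v).2 (((hD w).1 hw).of_edge he) hv
  have hfreeze : ∀ {f : V → (∀ v, X v) → (∀ u, Ω u) → ℝ≥0∞}, IsKernelFamily M.graph f →
      ∀ {E : Set (∀ v, X v)}, (∀ x x', (∀ v ∉ D, x v = x' v) → (x ∈ E ↔ x' ∈ E)) →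
      weightedMass (Measure.pi M.law) f (E.indicator 1) =
        weightedMass (Measure.pi M.law) (freeze D x₀ f) (E.indicator 1) := by
    refine fun {f} hf {E} hE => hf.weightedMass_freeze _ D x₀ hE fun w hw v hv x a ω => ?_
    exact hf.congr (Function.update_of_ne (ne_of_mem_of_not_mem hv hw).symm _ _)
      (fun b hb => Function.update_of_ne (by rintro rfl; exact hpar w hw b hv hb) _ _)
      fun _ _ => rfl
  have hc : ∀ x x' : ∀ v, X v, (∀ v ∉ D, x v = x' v) →
      (x ∈ evSet S s ∩ evVar T t' ↔ x' ∈ evSet S s ∩ evVar T t') := fun x x' h => by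
    simp only [Set.mem_inter_iff, mem_evVar, mem_evSet, fun v : S => h v (hSD v), h T hTD]
  have hcy : ∀ x x' : ∀ v, X v, (∀ v ∉ D, x v = x' v) →
      (x ∈ evVar Y y ∩ (evSet S s ∩ evVar T t') ↔
        x' ∈ evVar Y y ∩ (evSet S s ∩ evVar T t')) := fun x x' h => by
    exact and_congr (by rw [mem_evVar, mem_evVar, h Y hYD]) (hc x x' h)
  rw [massOf_swigDist, massOf_swigDist, massOf_obsDist, massOf_obsDist,
    hfreeze M.isKernelFamily_swigKernel hc, hfreeze M.isKernelFamily_swigKernel hcy,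
    hfreeze M.isKernelFamily_factor hc, hfreeze M.isKernelFamily_factor hcy]
  refine weightedMass_mul_swap M.law K (measurable_freeze M.measurable_swigKernel D x₀)
    (measurable_freeze M.measurable_factor D x₀) fun x x' ω ω' => ?_
  rw [mul_mul_mul_comm, mul_mul_mul_comm ((evSet S s ∩ evVar T t').indicator 1 _),
    ← Finset.prod_mul_distrib, ← Finset.prod_mul_distrib]
  have hswapC : ∀ z z' : ∀ v, X v, swapIn (Sum.inl ⁻¹' K) z z' ∈ evSet S s ∩ evVar T t' ↔
      z ∈ evSet S s ∩ evVar T t' := fun z z' => by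
    have h1 : ∀ v : S, swapIn (Sum.inl ⁻¹' K) z z' v = z v := fun v =>
      swapIn_inl_of_notMem (hKC _ (hSC v v.2))
    have h2 : swapIn (Sum.inl ⁻¹' K) z z' T = z T := swapIn_inl_of_notMem (hKC _ hTC)
    simp only [Set.mem_inter_iff, mem_evSet, mem_evVar, h1, h2]
  have hind : (evVar Y y ∩ (evSet S s ∩ evVar T t')).indicator (1 : (∀ v, X v) → ℝ≥0∞) x *
        (evSet S s ∩ evVar T t').indicator 1 x' =
      (evSet S s ∩ evVar T t').indicator 1 (swapIn (Sum.inl ⁻¹' K) x x') *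
        (evVar Y y ∩ (evSet S s ∩ evVar T t')).indicator 1 (swapIn (Sum.inl ⁻¹' K) x' x) := by
    refine indicator_one_mul_congr ?_
    have hY : swapIn (Sum.inl ⁻¹' K) x' x Y = x Y := swapIn_inl_of_mem hYK
    rw [Set.mem_inter_iff, Set.mem_inter_iff (a := evVar Y y), hswapC, hswapC,
      mem_evVar, mem_evVar, hY]
    tauto
  rw [← hind]
  by_cases hx : x ∈ evSet S s ∩ evVar T t' ∧ x' ∈ evSet S s ∩ evVar T t'
  swap
  · have h0 : (evVar Y y ∩ (evSet S s ∩ evVar T t')).indicator (1 : (∀ v, X v) → ℝ≥0∞) x *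
        (evSet S s ∩ evVar T t').indicator 1 x' = 0 := by
      rcases not_and_or.1 hx with h | h
      · rw [Set.indicator_of_notMem fun h' => h h'.2, zero_mul]
      · rw [Set.indicator_of_notMem h, mul_zero]
    rw [h0, zero_mul, zero_mul]
  obtain ⟨hxc, hxc'⟩ := hx
  congr 1
  -- Both copies agree on `C`, so that the exchange on `K` is an exchange on `K ∪ C`.
  have hagree : ∀ {v}, Sum.inl v ∈ C → x v = x' v := by
    intro v hv
    rcases Finset.mem_union.1 (CausalGraph.mem_obs.1 hv) with h | h
    · obtain rfl := Finset.mem_singleton.1 h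
      exact hxc.2.trans hxc'.2.symm
    · exact (hxc.1 ⟨v, h⟩).trans (hxc'.1 ⟨v, h⟩).symm
  have hin : ∀ {v}, Sum.inl v ∈ K ∨ Sum.inl v ∈ C → swapIn (Sum.inl ⁻¹' K) x x' v = x' v ∧
      swapIn (Sum.inl ⁻¹' K) x' x v = x v := by
    rintro v (h | h)
    · exact ⟨swapIn_inl_of_mem h, swapIn_inl_of_mem h⟩
    · exact ⟨(swapIn_inl_of_notMem (hKC _ h)).trans (hagree h),
        (swapIn_inl_of_notMem (hKC _ h)).trans (hagree h).symm⟩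
  have hlat : ∀ {u : U}, (Sum.inr u : V ⊕ U) ∈ K ∨ Sum.inr u ∈ C → (Sum.inr u : V ⊕ U) ∈ K :=
    fun h => h.resolve_right CausalGraph.inr_notMem_obs
  refine Finset.prod_congr rfl fun v _ => ?_
  by_cases hvD : v ∈ D
  · have hvK : Sum.inl v ∉ K := fun h => (hD v).2 h.1 hvD
    congr 1
    · exact freeze_congr hvD (swapIn_inl_of_notMem hvK).symm _ _
    · exact freeze_congr hvD (swapIn_inl_of_notMem hvK).symm _ _
  rw [freeze_of_notMem hvD, freeze_of_notMem hvD]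
  by_cases hv : Sum.inl v ∈ K ∨ ∃ w ∈ K, M.graph.Edge w (Sum.inl v)
  · -- The kernels that involve `K` are exchanged; none of them belongs to a child of `T`.
    obtain ⟨hvKC, hpKC⟩ := CausalGraph.family_subset_comp ((hD v).1 hvD) hv
    have hvT : ¬ M.graph.Edge (Sum.inl T) (Sum.inl v) := fun h => hcomp v h hv
    rw [M.swigKernel_eq_factor x ω fun h => (hvT h).elim,
      M.swigKernel_eq_factor _ _ fun h => (hvT h).elim, mul_comm]
    congr 1
    · exact M.factor_congr (hin hvKC).1.symm (fun a ha => (hin (hpKC _ ha)).1.symm)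
        fun u hu => (swapIn_inr_of_mem (hlat (hpKC _ hu))).symm
    · exact M.factor_congr (hin hvKC).2.symm (fun a ha => (hin (hpKC _ ha)).2.symm)
        fun u hu => (swapIn_inr_of_mem (hlat (hpKC _ hu))).symm
  · push Not at hv
    congr 1
    · exact M.isKernelFamily_swigKernel.congr (swapIn_inl_of_notMem hv.1).symm
        (fun a ha => (swapIn_inl_of_notMem fun h => hv.2 _ h ha).symm)
        fun u hu => (swapIn_inr_of_notMem fun h => hv.2 _ h hu).symm
    · exact M.factor_congr (swapIn_inl_of_notMem hv.1).symm
        (fun a ha => (swapIn_inl_of_notMem fun h => hv.2 _ h ha).symm)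
        fun u hu => (swapIn_inr_of_notMem fun h => hv.2 _ h hu).symm

/-! ### The front-door formula -/

/-- The front-door formula for any set `S` that is independent of `T` after the edges out of `T` are
deleted, and that together with `T` screens `Y` off from what the children of `T` are fed. -/
theorem causalEffect_eq_frontDoor {Y : V} {S : Finset V} (hYT : Y ≠ T) (hYS : Y ∉ S)
    (hS : ∀ a w, ReflTransGen M.graph.Edge a (Sum.inl T) →
      ReflTransGen (M.graph.EdgeAvoiding T) a w → w ∉ CausalGraph.obs S)
    (hcomp : ∀ v, M.graph.Edge (Sum.inl T) (Sum.inl v) →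
      ¬ (Sum.inl v ∈ M.graph.comp (CausalGraph.obs ({T} ∪ S)) (Sum.inl Y) ∨
        ∃ w ∈ M.graph.comp (CausalGraph.obs ({T} ∪ S)) (Sum.inl Y), M.graph.Edge w (Sum.inl v)))
    (ht : 0 < massOf M.obsDist (evVar T t)) (hover : Overlap M.obsDist T S t) (y : X Y) :
    M.causalEffect T Y t y = frontDoor M.obsDist T Y S t y := by
  obtain ⟨x₀⟩ : Nonempty (∀ v, X v) := by
    by_contra h
    rw [not_nonempty_iff] at h
    simp [massOf] at ht
  have hfin := M.massOf_obsDist_ne_top x₀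
  have hind := M.massOf_swigDist_evSet_inter_evVar (t := t) x₀ hS
  have hcond : ∀ s, condMass M.obsDist (evSet S s) (evVar T t) =
      massOf (M.swigDist T t) (evSet S s) := fun s => by
    rw [condMass, ← massOf_swigDist_inter_evVar, hind, ENNReal.mul_div_cancel_right ht.ne' (hfin _)]
  have hsum : massOf (M.swigDist T t) (evVar Y y) = ∑' (s : ∀ v : S, X v) (t' : X T),
      massOf (M.swigDist T t) (evVar Y y ∩ (evSet S s ∩ evVar T t')) := by
    rw [massOf_eq_tsum_fiber _ _ fun x (v : S) => x v]
    refine tsum_congr fun s => ?_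
    rw [massOf_eq_tsum_fiber _ _ fun x => x T]
    refine tsum_congr fun t' => congrArg _ ?_
    ext x
    simp only [Set.mem_inter_iff, mem_evVar, mem_evSet, Set.mem_ofPred_eq, funext_iff, and_assoc]
  rw [M.causalEffect_eq_massOf_swigDist x₀ hYT, hsum, frontDoor]
  refine tsum_congr fun s => ?_
  rw [hcond, ← ENNReal.tsum_mul_right]
  refine tsum_congr fun t' => ?_
  by_cases hw : massOf M.obsDist (evVar T t') = 0 ∨ massOf (M.swigDist T t) (evSet S s) = 0
  · have h0 : massOf (M.swigDist T t) (evSet S s ∩ evVar T t') = 0 := by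
      rw [hind]
      exact mul_eq_zero.2 hw.symm
    have h1 : massOf (M.swigDist T t) (evVar Y y ∩ (evSet S s ∩ evVar T t')) = 0 :=
      le_antisymm ((massOf_mono _ Set.inter_subset_right).trans_eq h0) zero_le
    rcases hw with h | h <;> simp [h1, h]
  obtain ⟨ht', hs⟩ := not_or.1 hw
  have hpos : 0 < massOf M.obsDist (evSet S s ∩ evVar T t') := by
    refine hover s t' (pos_iff_ne_zero.2 ht') ?_
    rw [← massOf_swigDist_inter_evVar, hind]
    exact ENNReal.mul_pos hs ht.ne'
  have hmul := M.massOf_swigDist_mul_massOf_obsDist x₀ hYT hYS hcomp s t' y (t := t)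
  rw [hind] at hmul
  rw [(ENNReal.eq_div_iff hpos.ne' (hfin _)).2 ((mul_comm _ _).trans hmul), condMass]
  simp only [div_eq_mul_inv]
  ring

end SMCM

theorem theorem2 {V U : Type*} [Fintype V] [DecidableEq V] [Fintype U]
    {X : V → Type*} [∀ v, Countable (X v)]
    {Ω : U → Type*} [∀ u, MeasurableSpace (Ω u)]
    (M : SMCM V U X Ω) (T Y : V)
    -- the outcome is a descendant of the treatment
    (hdesc : M.graph.IsDescendant (Sum.inl Y) (Sum.inl T))
    -- there is an unobserved confounder of the treatment and the outcome
    (hconf : ∃ u : U, M.graph.Edge (Sum.inr u) (Sum.inl T) ∧ M.graph.Edge (Sum.inr u) (Sum.inl Y))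
    -- `B` is the set of all children of the treatment
    (B : Finset V) (hB : ∀ v, v ∈ B ↔ M.graph.Edge (Sum.inl T) (Sum.inl v))
    (Z Zi Zo : Finset V) (hTZ : T ∉ Z) (hYZ : Y ∉ Z) (hBZ : Disjoint B Z)
    (hZo : Zo ⊆ Z) (hZi : Zi = Z \ Zo)
    (hsep : M.graph.DSep (CausalGraph.obs B) (CausalGraph.obs {Y}) (CausalGraph.obs ({T} ∪ Z)))
    (hsepi : M.graph.DSep (CausalGraph.obs Zi) (CausalGraph.obs {T}) ∅)
    (hsepo : M.graph.DSep (CausalGraph.obs Zo) (CausalGraph.obs {T}) (CausalGraph.obs (B ∪ Zi)))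
    (t : X T) (ht : 0 < massOf M.obsDist (evVar T t)) :
    (Overlap M.obsDist T Z t →
      ∀ y : X Y, M.causalEffect T Y t y = frontDoor M.obsDist T Y Z t y) ∧
    (Overlap M.obsDist T (B ∪ Zi) t →
      ∀ y : X Y, M.causalEffect T Y t y = frontDoor M.obsDist T Y (B ∪ Zi) t y) := by
  have hYT : Y ≠ T := by
    rintro rfl
    exact M.graph.acyclic _ hdesc
  have hZiZ : Zi ⊆ Z := hZi ▸ Finset.sdiff_subset
  have hZ : ∀ v, v ∈ Z ↔ v ∈ Zo ∨ v ∈ Zi := by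
    intro v
    rw [hZi, Finset.mem_sdiff]
    have := @hZo v
    tauto
  have hYB : Y ∉ B := fun h => Set.disjoint_left.1 hsep.1 (CausalGraph.mem_obs.2 h)
    (CausalGraph.mem_obs.2 (Finset.mem_singleton_self Y))
  have hanc : ∀ a w, Relation.ReflTransGen M.graph.Edge a (Sum.inl T) →
      Relation.ReflTransGen (M.graph.EdgeAvoiding T) a w → w ∉ CausalGraph.obs (B ∪ Z) :=
    fun a w => CausalGraph.notMem_of_common_ancestor hconf hYT hYZ (fun v => (hZ v).1) hZiZ
      hsep hsepi hsepo
  have hmono : ∀ {S : Finset V}, S ⊆ B ∪ Z → ∀ a w,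
      Relation.ReflTransGen M.graph.Edge a (Sum.inl T) →
      Relation.ReflTransGen (M.graph.EdgeAvoiding T) a w → w ∉ CausalGraph.obs S :=
    fun h a w ha hw hwS => hanc a w ha hw (Set.image_mono (Finset.coe_subset.2 h) hwS)
  have hBY : ∀ v, M.graph.Edge (Sum.inl T) (Sum.inl v) → ∀ b,
      ¬ M.graph.Reach (CausalGraph.obs ({T} ∪ Z)) (Sum.inl Y) (Sum.inl v) b := fun v hv b =>
    hsep.not_reach (CausalGraph.mem_obs.2 ((hB v).2 hv))
      (CausalGraph.mem_obs.2 (Finset.mem_singleton_self Y)) b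
  constructor
  · refine fun hover y => M.causalEffect_eq_frontDoor hYT hYZ
      (hmono Finset.subset_union_right) (fun v hv => ?_) ht hover y
    rintro (⟨-, -, b, hb⟩ | ⟨w, ⟨-, hwC, b, hb⟩, he⟩)
    · exact hBY v hv b hb
    · exact hBY v hv true (hb.forward hwC he)
  · refine fun hover y => M.causalEffect_eq_frontDoor hYT
      (by simpa [hYB] using fun h => hYZ (hZiZ h))
      (hmono (Finset.union_subset_union_right hZiZ)) (fun v hv => ?_) ht hover y
    rintro (⟨-, hvC, -⟩ | ⟨w, ⟨-, hwC, b, hb⟩, he⟩)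
    · exact hvC (CausalGraph.mem_obs.2 (by simp [(hB v).2 hv]))
    · exact CausalGraph.not_reach_parent_of_child hB hZ hsep hsepo hb hwC ((hB v).2 hv) he
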